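/- **Theorem.** For a real matrix $A\in\mathbb{R}^{m\times n}$ and a positive integer $s$, the $s$-th restricted isometry constant $\delta_s(A)$ is the smallest $\delta\ge 0$ such that $(1-\delta)\|x\|_2^2\le\|Ax\|_2^2\le(1+\delta)\|x\|_2^2$ for all $x\in\mathbb{R}^n$ with at most $s$ nonzero entries. Given $\varphi=(\varphi_0,\dots,\varphi_{n-1})\in\mathbb{R}^n$, let $\Phi^\circ\in\mathbb{R}^{n\times n}$ be the circulant matrix with entries $\Phi^\circ_{ij}=\varphi_{(i-j)\bmod n}$, $0\le i,j\le n-1$. For a nonempty set $\Omega\subset\{0,\dots,n-1\}$ with $|\Omega|=m$, let $R_\Omega\in\mathbb{R}^{m\times n}$ be the operator that restricts a vector to the entries listed in $\Omega$, and let $\Phi=m^{-1/2}R_\Omega\Phi^\circ$. There are universal constants $C_1,C_2>0$ such that the following hold for every $n\ge 1$, every $s\ge 1$ and every (arbitrary, nonrandom) nonempty $\Omega\subset\{0,\dots,n-1\}$, $m=|\Omega|$, when $\varphi$ is a Rademacher sequence, that is, when $\varphi_0,\dots,\varphi_{n-1}$ are independent random variables, each taking the values $+1$ and $-1$ with probability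 $1/2$. 1. The random variable $\delta_s=\delta_s(\Phi)$ is integrable and $$\mathbb{E}[\delta_s]\le C_1\max\Big\{\frac{s^{3/2}}{m}\log^{3/2}n,\ \sqrt{\frac{s}{m}}\,\log s\,\log n\Big\}.$$ 2. For every $\delta\in(0,1)$, if $$m\ge C_2\max\big\{\delta^{-1}s^{3/2}\log^{3/2}n,\ \delta^{-2}s\log^2 n\,\log^2 s\big\},$$ then $\mathbb{E}[\delta_s]\le\delta$. -/

import Mathlib

open MeasureTheory ProbabilityTheory
open scoped Matrix

/-- The number of nonzero entries `‖x‖₀` of a vector. -/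
noncomputable def l0norm {κ : Type*} [Fintype κ] (x : κ → ℝ) : ℕ :=
  Set.ncard {j | x j ≠ 0}

/-- The squared Euclidean norm `‖x‖₂²` of a vector. -/
noncomputable def l2normSq {κ : Type*} [Fintype κ] (x : κ → ℝ) : ℝ :=
  ‖(WithLp.toLp 2 x : EuclideanSpace ℝ κ)‖ ^ 2

/-- The set of all `δ ≥ 0` for which `A` satisfies the two-sided restricted isometry estimate
on `s`-sparse vectors. -/
def ripBounds {ι κ : Type*} [Fintype ι] [Fintype κ] (A : Matrix ι κ ℝ) (s : ℕ) : Set ℝ :=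
  {δ | 0 ≤ δ ∧ ∀ x : κ → ℝ, l0norm x ≤ s →
    (1 - δ) * l2normSq x ≤ l2normSq (A *ᵥ x) ∧ l2normSq (A *ᵥ x) ≤ (1 + δ) * l2normSq x}

/-- The `s`-th restricted isometry constant of `A`. The infimum is over a nonempty closed set
of nonnegative reals, so it is attained; allowing `δ = 0` or not does not change its value. -/
noncomputable def ripConst {ι κ : Type*} [Fintype ι] [Fintype κ]
    (A : Matrix ι κ ℝ) (s : ℕ) : ℝ :=
  sInf (ripBounds A s)

/-- The operator `R_Ω` that restricts a vector in `ℝⁿ` to the entries listed in `Ω`. -/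
def restrictionMatrix {n : ℕ} (Ω : Finset (Fin n)) : Matrix Ω (Fin n) ℝ :=
  Matrix.of fun i j => if (i : Fin n) = j then 1 else 0

/-- The partial circulant matrix `m^{-1/2} R_Ω Φ°`, `m = |Ω|`, where `Φ°` is the circulant matrix
with entries `Φ°(i, j) = φ (i - j mod n)`. -/
noncomputable def partialCirculant {n : ℕ} (Ω : Finset (Fin n)) (φ : Fin n → ℝ) :
    Matrix Ω (Fin n) ℝ :=
  (1 / Real.sqrt (Ω.card : ℝ)) • (restrictionMatrix Ω * Matrix.circulant φ)

/-- A Rademacher sequence: independent random variables, each taking the values `+1` and `-1`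
with probability one half. -/
structure IsRademacher {S : Type*} [MeasurableSpace S] (P : Measure S) {n : ℕ}
    (ε : Fin n → S → ℝ) : Prop where
  measurable : ∀ k, Measurable (ε k)
  indep : iIndepFun ε P
  prob_one : ∀ k, P {ω | ε k ω = 1} = 1 / 2
  prob_neg_one : ∀ k, P {ω | ε k ω = -1} = 1 / 2

/-! The squared norm `‖Φ x‖²` of the partial circulant matrix applied to `x` is, after exchanging the
roles of the generator and the argument, `‖V x ξ‖²` for the partial convolution operator `V x` and
the vector `ξ` of random signs. Its mean is the squared Hilbert–Schmidt norm of `V x`, which equals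
`‖x‖²`, so the restricted isometry constant is the supremum of the centred Rademacher chaos
`‖V x ξ‖² - ‖x‖²` over sparse unit vectors. Since a Rademacher sequence takes almost surely finitely
many values, all expectations are averages over sign vectors `Fin n → ℤˣ`.

*Decoupling.* For signs `η`, `‖V ξ‖² - ‖V (ηξ)‖² = ⟪V (ξ + ηξ), V (ξ - ηξ)⟫`, and averaging over `η`
gives the centred chaos. The two arguments have disjoint supports, hence are independent for fixed
`η`, and conditionally on one of them the form is a Rademacher sum, for which the expected maximum
over `N` choices is at most `√(2 log (2N))` times the largest norm
(`expect_sup_abs_inner_signVec_le`). Taking both operators equal also bounds the expected maximum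
of `N` norms `‖V ξ‖` by `1 + 4 D' √(2 log (2N))`, where `D'` bounds the operator norms
(`expect_sup_norm_map_signVec_le`).

*Chaining.* The increments of the bilinear form along a chain of finite approximating sets are again
such forms. A link of length `D` between sets with at most `N` points thus costs
`8 D L (1 + 4 D' L)` with `L = √(2 log (2N))` (`expect_sup_chaos_le_sum`); this yields both the
subgaussian term, linear in `L`, and the subexponential term, quadratic in `L`.

*Covering numbers.* By Parseval's identity `‖V x‖ ≤ m^{-1/2} sup_ψ |x̂(ψ)|` (`norm_partialConv_le`).
Sparse unit vectors lie in the `ℓ¹`-ball of radius `√s`, and a greedy form of Maurey's empirical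
method covers subsets of this ball at scale `u` in the supremum norm of the Fourier transform by
`exp (C s log² n / u²)` points (`exists_fourier_net`). At scales below `√(log n)` the chain jumps to a
net of roundings of the sparse vectors, of cardinality `exp (C s log n)` (`exists_sparse_net`). Only
`O(log s)` dyadic scales between `√(log n)` and `√s` remain, and summing the costs of the links gives
the two terms of the bound (`expect_ripConst_le_of_two_le`). This uses `2 ≤ s ≤ n`. Replacing `s` by
`min s n` does not change the restricted isometry constant, and for `min s n = 1`, where `log s` can
no longer count the scales, the constant vanishes because the columns of `Φ` are unit vectors. -/

open scoped BigOperators RealInnerProductSpace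

/-! ### Averages over sign vectors and the maximal inequality -/

/-- The vector in Euclidean space whose coordinates are the signs `ξ k = ±1`. -/
noncomputable def signVec {κ : Type*} (ξ : κ → ℤˣ) : EuclideanSpace ℝ κ :=
  WithLp.toLp 2 fun k => ((ξ k : ℤ) : ℝ)

@[simp] lemma signVec_apply {κ : Type*} (ξ : κ → ℤˣ) (k : κ) : signVec ξ k = ((ξ k : ℤ) : ℝ) := rfl

lemma intUnit_sq (u : ℤˣ) : ((u : ℤ) : ℝ) * ((u : ℤ) : ℝ) = 1 := by
  rcases Int.units_eq_one_or u with rfl | rfl <;> simp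

/-- The factor `√(2 log (2N))` by which the expected maximum of `N` Rademacher sums can exceed
the largest norm of their coefficient vectors. -/
noncomputable def maxFactor (N : ℕ) : ℝ := √(2 * Real.log (2 * N))

lemma maxFactor_nonneg (N : ℕ) : 0 ≤ maxFactor N := Real.sqrt_nonneg _

lemma expect_prod_pi {κ : Type*} [Fintype κ] [DecidableEq κ] (g : κ → ℤˣ → ℝ) :
    𝔼 ξ : κ → ℤˣ, ∏ k, g k (ξ k) = ∏ k, 𝔼 u : ℤˣ, g k u := by
  simp only [Fintype.expect_eq_sum_div_card, Finset.prod_div_distrib]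
  rw [Finset.prod_univ_sum, Fintype.piFinset_univ, Fintype.card_pi, Nat.cast_prod]

lemma expect_intUnits (g : ℤˣ → ℝ) : 𝔼 u : ℤˣ, g u = (g 1 + g (-1)) / 2 := by
  rw [Fintype.expect_eq_sum_div_card]
  have : (Finset.univ : Finset ℤˣ) = {1, -1} := rfl
  simp [this]

section

variable {κ : Type*} [Fintype κ] [DecidableEq κ]

lemma expect_exp_inner_signVec_le (c : EuclideanSpace ℝ κ) (l : ℝ) :
    𝔼 ξ : κ → ℤˣ, Real.exp (l * ⟪signVec ξ, c⟫) ≤ Real.exp (l ^ 2 * ‖c‖ ^ 2 / 2) := by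
  have h : ∀ ξ : κ → ℤˣ, Real.exp (l * ⟪signVec ξ, c⟫)
      = ∏ k, Real.exp (l * (((ξ k : ℤ) : ℝ) * c k)) := by
    intro ξ
    rw [← Real.exp_sum, ← Finset.mul_sum]
    congr 2
    simp [PiLp.inner_apply, mul_comm]
  simp only [h]
  rw [expect_prod_pi (fun k u => Real.exp (l * (((u : ℤ) : ℝ) * c k)))]
  calc _ ≤ ∏ k, Real.exp (l ^ 2 * c k ^ 2 / 2) := by
        refine Finset.prod_le_prod (fun k _ => Finset.expect_nonneg fun u _ => (Real.exp_pos _).le)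
          fun k _ => ?_
        rw [expect_intUnits]
        have := Real.cosh_le_exp_half_sq (l * c k)
        rw [Real.cosh_eq] at this
        simpa [mul_pow] using this
    _ = _ := by
        rw [← Real.exp_sum, EuclideanSpace.norm_sq_eq, Finset.mul_sum, Finset.sum_div]
        simp

/-- Maximal inequality for Rademacher sums. -/
lemma expect_sup_abs_inner_signVec_le {ι : Type*} {s : Finset ι} (hs : s.Nonempty) {N : ℕ}
    (hN : s.card ≤ N) (c : ι → EuclideanSpace ℝ κ) {R : ℝ} (hR : ∀ i ∈ s, ‖c i‖ ≤ R) :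
    𝔼 ξ : κ → ℤˣ, s.sup' hs (fun i => |⟪signVec ξ, c i⟫|) ≤ R * maxFactor N := by
  have hR0 : 0 ≤ R := by
    obtain ⟨i, hi⟩ := hs
    exact (norm_nonneg _).trans (hR i hi)
  rcases hR0.eq_or_lt with rfl | hRpos
  · refine Finset.expect_le Finset.univ_nonempty fun ξ _ => ?_
    rw [zero_mul]
    refine Finset.sup'_le _ _ fun i hi => ?_
    have : c i = 0 := norm_le_zero_iff.1 (hR i hi)
    simp [this]
  have hN1 : (1 : ℝ) ≤ N := by
    exact_mod_cast (Finset.card_pos.2 hs).trans_le hN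
  have hlog : 0 < Real.log (2 * N) := Real.log_pos (by linarith)
  have hL : 0 < maxFactor N := Real.sqrt_pos.2 (by positivity)
  have hLsq : maxFactor N ^ 2 = 2 * Real.log (2 * N) := Real.sq_sqrt (by positivity)
  set M : (κ → ℤˣ) → ℝ := fun ξ => s.sup' hs (fun i => |⟪signVec ξ, c i⟫|) with hM
  set l : ℝ := maxFactor N / R with hl
  have hlpos : 0 < l := div_pos hL hRpos
  set A : ℝ := 2 * N * Real.exp (l ^ 2 * R ^ 2 / 2) with hA
  have hApos : 0 < A := by positivity
  -- The exponential of the maximum is dominated by the sum of all exponentials.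
  have hexp : 𝔼 ξ, Real.exp (l * M ξ) ≤ A := by
    calc 𝔼 ξ, Real.exp (l * M ξ)
        ≤ 𝔼 ξ, ∑ i ∈ s, (Real.exp (l * ⟪signVec ξ, c i⟫) + Real.exp (-l * ⟪signVec ξ, c i⟫)) := by
          refine Finset.expect_le_expect fun ξ _ => ?_
          obtain ⟨i, hi, hiM⟩ := Finset.exists_mem_eq_sup' hs (fun i => |⟪signVec ξ, c i⟫|)
          have hMi : M ξ = |⟪signVec ξ, c i⟫| := hiM
          rw [hMi]
          refine le_trans ?_ (Finset.single_le_sum (f := fun i => Real.exp (l * ⟪signVec ξ, c i⟫) +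
            Real.exp (-l * ⟪signVec ξ, c i⟫)) (fun i _ => by positivity) hi)
          rcases abs_cases (⟪signVec ξ, c i⟫ : ℝ) with ⟨h, _⟩ | ⟨h, _⟩
          · rw [h]
            have := Real.exp_pos (-l * ⟪signVec ξ, c i⟫)
            linarith
          · rw [h, mul_neg, ← neg_mul]
            have := Real.exp_pos (l * ⟪signVec ξ, c i⟫)
            linarith
      _ = ∑ i ∈ s, (𝔼 ξ, Real.exp (l * ⟪signVec ξ, c i⟫)
            + 𝔼 ξ, Real.exp (-l * ⟪signVec ξ, c i⟫)) := by
          rw [Finset.expect_sum_comm]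
          simp only [Finset.expect_add_distrib]
      _ ≤ ∑ _i ∈ s, 2 * Real.exp (l ^ 2 * R ^ 2 / 2) := by
          refine Finset.sum_le_sum fun i hi => ?_
          have h1 := expect_exp_inner_signVec_le (c i) l
          have h2 := expect_exp_inner_signVec_le (c i) (-l)
          rw [neg_sq] at h2
          have h3 : Real.exp (l ^ 2 * ‖c i‖ ^ 2 / 2) ≤ Real.exp (l ^ 2 * R ^ 2 / 2) := by
            have := hR i hi
            gcongr
          linarith
      _ ≤ A := by
          rw [Finset.sum_const, nsmul_eq_mul, hA]
          have : (s.card : ℝ) ≤ N := by exact_mod_cast hN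
          nlinarith [Real.exp_pos (l ^ 2 * R ^ 2 / 2)]
  -- Jensen's inequality in tangent form: `t ≤ exp t / A - 1 + log A`.
  have hjen : l * 𝔼 ξ, M ξ ≤ Real.log A := by
    calc l * 𝔼 ξ, M ξ = 𝔼 ξ, l * M ξ := Finset.mul_expect ..
      _ ≤ 𝔼 ξ : κ → ℤˣ, (Real.exp (l * M ξ) / A + (Real.log A - 1)) := by
          refine Finset.expect_le_expect fun ξ _ => ?_
          have := Real.log_le_sub_one_of_pos (x := Real.exp (l * M ξ) / A) (by positivity)
          rw [Real.log_div (Real.exp_ne_zero _) hApos.ne', Real.log_exp] at this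
          linarith
      _ = (𝔼 ξ, Real.exp (l * M ξ)) / A + (Real.log A - 1) := by
          rw [Finset.expect_add_distrib, Finset.expect_div, Fintype.expect_const]
      _ ≤ Real.log A := by
          have := (div_le_one hApos).2 hexp
          linarith
  have hlogA : Real.log A = maxFactor N ^ 2 := by
    rw [hA, Real.log_mul (by positivity) (Real.exp_ne_zero _), Real.log_exp, hl]
    field_simp
    rw [hLsq]; ring
  rw [hlogA, hl, div_mul_eq_mul_div, div_le_iff₀ hRpos] at hjen
  have : maxFactor N * 𝔼 ξ, M ξ ≤ maxFactor N * (R * maxFactor N) := by nlinarith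
  exact le_of_mul_le_mul_left this hL

lemma expect_signs_mul (τ : κ → ℤˣ) (F : (κ → ℤˣ) → ℝ) :
    𝔼 ξ : κ → ℤˣ, F (τ * ξ) = 𝔼 ξ, F ξ :=
  Fintype.expect_equiv (Equiv.mulLeft τ) _ _ fun _ => rfl

variable {H : Type*} [NormedAddCommGroup H] [InnerProductSpace ℝ H]

/-- The square of the Hilbert–Schmidt (Frobenius) norm of an operator on Euclidean space. -/
noncomputable def hsNormSq (V : EuclideanSpace ℝ κ →L[ℝ] H) : ℝ :=
  ∑ k, ‖V (EuclideanSpace.single k 1)‖ ^ 2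

lemma map_signVec (V : EuclideanSpace ℝ κ →L[ℝ] H) (ξ : κ → ℤˣ) :
    V (signVec ξ) = ∑ k, ((ξ k : ℤ) : ℝ) • V (EuclideanSpace.single k 1) := by
  have : signVec ξ = ∑ k, ((ξ k : ℤ) : ℝ) • EuclideanSpace.single k (1 : ℝ) := by
    ext j
    simp [Pi.single_apply]
  rw [this, map_sum]
  simp

/-- Distinct Rademacher variables are uncorrelated. -/
lemma expect_sign_mul_sign (j k : κ) :
    𝔼 ξ : κ → ℤˣ, ((ξ j : ℤ) : ℝ) * ((ξ k : ℤ) : ℝ) = if j = k then 1 else 0 := by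
  split_ifs with h
  · subst h
    simp only [intUnit_sq]
    exact Fintype.expect_const _
  · -- Flipping the sign at `j` changes the sign of the average.
    have := expect_signs_mul (Function.update 1 j (-1))
      (fun ξ : κ → ℤˣ => ((ξ j : ℤ) : ℝ) * ((ξ k : ℤ) : ℝ))
    simp only [Pi.mul_apply, Function.update_self, Function.update_of_ne (Ne.symm h),
      Pi.one_apply, one_mul, neg_mul, Units.val_neg, Int.cast_neg,
      Finset.expect_neg_distrib] at this
    linarith

lemma expect_norm_map_signVec_sq (V : EuclideanSpace ℝ κ →L[ℝ] H) :
    𝔼 ξ : κ → ℤˣ, ‖V (signVec ξ)‖ ^ 2 = hsNormSq V := by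
  have h : ∀ ξ : κ → ℤˣ, ‖V (signVec ξ)‖ ^ 2 = ∑ j, ∑ k, ((ξ j : ℤ) : ℝ) * ((ξ k : ℤ) : ℝ) *
      ⟪V (EuclideanSpace.single j 1), V (EuclideanSpace.single k 1)⟫ := by
    intro ξ
    rw [← real_inner_self_eq_norm_sq, map_signVec, sum_inner]
    refine Finset.sum_congr rfl fun j _ => ?_
    rw [inner_sum]
    refine Finset.sum_congr rfl fun k _ => ?_
    rw [real_inner_smul_left, real_inner_smul_right]
    ring
  simp only [h, Finset.expect_sum_comm, ← Finset.expect_mul, expect_sign_mul_sign]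
  simp [hsNormSq]

end

/-! ### Decoupling and chaining -/

section

variable {κ : Type*} [Fintype κ] [DecidableEq κ]
  {H : Type*} [NormedAddCommGroup H] [InnerProductSpace ℝ H]

/-- Symmetrization and decoupling in one step: the deviation of `‖V ξ‖²` from its mean is the
average over `η` of `⟪V (ξ + ηξ), V (ξ - ηξ)⟫ = ‖V ξ‖² - ‖V (ηξ)‖²`. -/
lemma expect_sup_abs_norm_sq_sub_le {ι : Type*} {s : Finset ι} (hs : s.Nonempty)
    (V : ι → EuclideanSpace ℝ κ →L[ℝ] H) {B : ℝ}
    (hB : ∀ η : κ → ℤˣ, 𝔼 ξ : κ → ℤˣ, s.sup' hs (fun i => |⟪V i (signVec ξ + signVec (η * ξ)),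
        V i (signVec ξ - signVec (η * ξ))⟫|) ≤ B) :
    𝔼 ξ : κ → ℤˣ, s.sup' hs (fun i => |‖V i (signVec ξ)‖ ^ 2 - hsNormSq (V i)|) ≤ B := by
  calc 𝔼 ξ : κ → ℤˣ, s.sup' hs (fun i => |‖V i (signVec ξ)‖ ^ 2 - hsNormSq (V i)|)
      ≤ 𝔼 ξ : κ → ℤˣ, 𝔼 η : κ → ℤˣ, s.sup' hs (fun i =>
          |⟪V i (signVec ξ + signVec (η * ξ)), V i (signVec ξ - signVec (η * ξ))⟫|) := by
        refine Finset.expect_le_expect fun ξ _ => Finset.sup'_le _ _ fun i hi => ?_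
        have h : ‖V i (signVec ξ)‖ ^ 2 - hsNormSq (V i) = 𝔼 η : κ → ℤˣ,
            ⟪V i (signVec ξ + signVec (η * ξ)), V i (signVec ξ - signVec (η * ξ))⟫ := by
          have h1 : ∀ η : κ → ℤˣ, (⟪V i (signVec ξ + signVec (η * ξ)),
              V i (signVec ξ - signVec (η * ξ))⟫ : ℝ)
              = ‖V i (signVec ξ)‖ ^ 2 - ‖V i (signVec (ξ * η))‖ ^ 2 := by
            intro η
            rw [map_add, map_sub, inner_sub_right, inner_add_left, inner_add_left,
              real_inner_self_eq_norm_sq, real_inner_self_eq_norm_sq, mul_comm η,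
              real_inner_comm]
            ring
          simp only [h1]
          rw [Finset.expect_sub_distrib, Fintype.expect_const,
            expect_signs_mul ξ (fun η => ‖V i (signVec η)‖ ^ 2), expect_norm_map_signVec_sq]
        rw [h]
        refine (Finset.abs_expect_le _ _).trans (Finset.expect_le_expect fun η _ => ?_)
        exact Finset.le_sup' (fun i => |⟪V i (signVec ξ + signVec (η * ξ)),
          V i (signVec ξ - signVec (η * ξ))⟫|) hi
    _ = 𝔼 η : κ → ℤˣ, 𝔼 ξ : κ → ℤˣ, s.sup' hs (fun i =>
          |⟪V i (signVec ξ + signVec (η * ξ)), V i (signVec ξ - signVec (η * ξ))⟫|) :=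
        Finset.expect_comm _ _ _
    _ ≤ B := Finset.expect_le Finset.univ_nonempty fun η _ => hB η

variable [CompleteSpace H]

/-- Conditional maximal inequality for the partially decoupled chaos. The vectors `ξ + ηξ` and
`ξ - ηξ` are supported on the disjoint sets `{η = 1}` and `{η = -1}`, so for fixed `η` they are
independent; conditionally on the second one, the form is a Rademacher sum in the first. -/
lemma expect_sup_abs_decoupled_le {ι : Type*} {s : Finset ι} (hs : s.Nonempty) {N : ℕ}
    (hN : s.card ≤ N) (W V : ι → EuclideanSpace ℝ κ →L[ℝ] H) {D : ℝ}
    (hW : ∀ i ∈ s, ‖W i‖ ≤ D) (η : κ → ℤˣ) :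
    𝔼 ξ : κ → ℤˣ, s.sup' hs (fun i => |⟪W i (signVec ξ + signVec (η * ξ)),
        V i (signVec ξ - signVec (η * ξ))⟫|) ≤
      4 * D * maxFactor N * 𝔼 ξ : κ → ℤˣ, s.sup' hs (fun i => ‖V i (signVec ξ)‖) := by
  have hD : 0 ≤ D := by
    obtain ⟨i, hi⟩ := hs
    exact (norm_nonneg _).trans (hW i hi)
  set G : (κ → ℤˣ) → ℝ := fun ξ => s.sup' hs (fun i => |⟪W i (signVec ξ + signVec (η * ξ)),
        V i (signVec ξ - signVec (η * ξ))⟫|) with hG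
  set m : (κ → ℤˣ) → ℝ := fun ξ => s.sup' hs (fun i => ‖V i (signVec ξ)‖) with hm
  -- Rerandomize the signs on `{η = 1}` only.
  set res : (κ → ℤˣ) → (κ → ℤˣ) := fun τ k => if η k = 1 then τ k else 1 with hres
  have key : ∀ ξ : κ → ℤˣ, 𝔼 τ, G (res τ * ξ) ≤ 2 * D * maxFactor N * (m ξ + m (η * ξ)) := by
    intro ξ
    set b := signVec ξ - signVec (η * ξ) with hb
    have hb' : ∀ τ, signVec (res τ * ξ) - signVec (η * (res τ * ξ)) = b := by
      intro τ
      ext k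
      rcases Int.units_eq_one_or (η k) with h | h <;> simp [hb, hres, h]
    set c : ι → EuclideanSpace ℝ κ := fun i => WithLp.toLp 2 fun k =>
      (((ξ k : ℤ) : ℝ) + (((η * ξ) k : ℤ) : ℝ)) * ((W i).adjoint (V i b)) k with hc
    have hin : ∀ τ i, (⟪W i (signVec (res τ * ξ) + signVec (η * (res τ * ξ))), V i b⟫ : ℝ)
        = ⟪signVec τ, c i⟫ := by
      intro τ i
      rw [← ContinuousLinearMap.adjoint_inner_right, PiLp.inner_apply, PiLp.inner_apply]
      refine Finset.sum_congr rfl fun k _ => ?_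
      rcases Int.units_eq_one_or (η k) with h | h
      · simp [hc, hres, h]; ring
      · simp [hc, hres, h]
    have hcn : ∀ i ∈ s, ‖c i‖ ≤ 2 * D * (m ξ + m (η * ξ)) := by
      intro i hi
      have h1 : ‖c i‖ ≤ 2 * ‖(W i).adjoint (V i b)‖ := by
        refine abs_le_of_sq_le_sq' ?_ (by positivity) |>.2
        rw [mul_pow, EuclideanSpace.norm_sq_eq, EuclideanSpace.norm_sq_eq, Finset.mul_sum]
        refine Finset.sum_le_sum fun k _ => ?_
        simp only [Real.norm_eq_abs, sq_abs]
        rcases Int.units_eq_one_or (η k) with h | h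
        · simp only [hc, Pi.mul_apply, h, one_mul, mul_pow]
          have := intUnit_sq (ξ k)
          nlinarith
        · simp only [hc, Pi.mul_apply, h, neg_mul, one_mul, Units.val_neg, Int.cast_neg,
            add_neg_cancel, zero_mul]
          rw [zero_pow two_ne_zero]
          positivity
      have h2 : ‖(W i).adjoint (V i b)‖ ≤ D * ‖V i b‖ := by
        refine ((W i).adjoint.le_opNorm _).trans ?_
        rw [LinearIsometryEquiv.norm_map]
        exact mul_le_mul_of_nonneg_right (hW i hi) (norm_nonneg _)
      have h3 : ‖V i b‖ ≤ m ξ + m (η * ξ) := by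
        rw [hb, map_sub]
        refine (norm_sub_le _ _).trans (add_le_add ?_ ?_)
        · exact Finset.le_sup' (fun i => ‖V i (signVec ξ)‖) hi
        · exact Finset.le_sup' (fun i => ‖V i (signVec (η * ξ))‖) hi
      calc ‖c i‖ ≤ 2 * (D * (m ξ + m (η * ξ))) := by
            refine h1.trans ?_
            have := mul_le_mul_of_nonneg_left h3 hD
            linarith
        _ = _ := by ring
    have := expect_sup_abs_inner_signVec_le hs hN c hcn
    calc 𝔼 τ, G (res τ * ξ) = 𝔼 τ : κ → ℤˣ, s.sup' hs (fun i => |⟪signVec τ, c i⟫|) := by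
          refine Finset.expect_congr rfl fun τ _ => ?_
          simp only [hG, hb', hin]
      _ ≤ _ := this
      _ = _ := by ring
  calc 𝔼 ξ, G ξ = 𝔼 τ : κ → ℤˣ, 𝔼 ξ, G (res τ * ξ) := by
        simp only [expect_signs_mul]
        rw [Fintype.expect_const]
    _ = 𝔼 ξ : κ → ℤˣ, 𝔼 τ, G (res τ * ξ) := Finset.expect_comm _ _ _
    _ ≤ 𝔼 ξ : κ → ℤˣ, 2 * D * maxFactor N * (m ξ + m (η * ξ)) :=
        Finset.expect_le_expect fun ξ _ => key ξ
    _ = 4 * D * maxFactor N * 𝔼 ξ, m ξ := by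
        rw [← Finset.mul_expect, Finset.expect_add_distrib, expect_signs_mul]
        ring

/-- The expected maximum of finitely many norms `‖V i ξ‖`. The second moment `M` of the maximum
satisfies the self-bounding inequality `M ≤ F² + 4 D L √M`, which is solved for `√M`. -/
lemma expect_sup_norm_map_signVec_le {ι : Type*} {s : Finset ι} (hs : s.Nonempty) {N : ℕ}
    (hN : s.card ≤ N) (V : ι → EuclideanSpace ℝ κ →L[ℝ] H) {D F : ℝ} (hF : 0 ≤ F)
    (hD : ∀ i ∈ s, ‖V i‖ ≤ D) (hV : ∀ i ∈ s, hsNormSq (V i) ≤ F ^ 2) :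
    𝔼 ξ : κ → ℤˣ, s.sup' hs (fun i => ‖V i (signVec ξ)‖) ≤ F + 4 * D * maxFactor N := by
  have hD0 : 0 ≤ D := by
    obtain ⟨i, hi⟩ := hs
    exact (norm_nonneg _).trans (hD i hi)
  have hL := maxFactor_nonneg N
  set m : (κ → ℤˣ) → ℝ := fun ξ => s.sup' hs (fun i => ‖V i (signVec ξ)‖) with hm
  have hdev := expect_sup_abs_norm_sq_sub_le hs V
    (fun η => expect_sup_abs_decoupled_le hs hN V V hD η)
  have h2 : 𝔼 ξ, m ξ ^ 2 ≤ F ^ 2 + 4 * D * maxFactor N * 𝔼 ξ, m ξ := by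
    refine le_trans ?_ (add_le_add_right hdev _)
    rw [← Fintype.expect_const (ι := κ → ℤˣ) (F ^ 2), ← Finset.expect_add_distrib]
    refine Finset.expect_le_expect fun ξ _ => ?_
    obtain ⟨i, hi, him⟩ := Finset.exists_mem_eq_sup' hs (fun i => ‖V i (signVec ξ)‖)
    have hmi : m ξ = ‖V i (signVec ξ)‖ := him
    rw [hmi]
    have h3 := Finset.le_sup' (fun i => |‖V i (signVec ξ)‖ ^ 2 - hsNormSq (V i)|) hi
    have h4 := le_abs_self (‖V i (signVec ξ)‖ ^ 2 - hsNormSq (V i))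
    have h5 := hV i hi
    linarith
  have h1 : (𝔼 ξ, m ξ) ^ 2 ≤ 𝔼 ξ, m ξ ^ 2 := by
    have := Finset.expect_mul_sq_le_sq_mul_sq (Finset.univ : Finset (κ → ℤˣ)) m (fun _ => 1)
    simpa [Fintype.expect_const] using this
  by_contra! hcon
  have : 0 ≤ 4 * D * maxFactor N := by positivity
  nlinarith

/-- The cost of a link of the chain: a decoupled bilinear form in which one operator has norm at
most `D` while the other belongs to a class with operator norm at most `D'` and
Hilbert–Schmidt norm at most `1`. -/
lemma expect_sup_abs_decoupled_le_of_hsNormSq_le {ι : Type*} {s : Finset ι} (hs : s.Nonempty)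
    {N : ℕ} (hN : s.card ≤ N) (W V : ι → EuclideanSpace ℝ κ →L[ℝ] H) {D D' : ℝ}
    (hW : ∀ i ∈ s, ‖W i‖ ≤ D) (hD : ∀ i ∈ s, ‖V i‖ ≤ D') (hV : ∀ i ∈ s, hsNormSq (V i) ≤ 1)
    (η : κ → ℤˣ) :
    𝔼 ξ : κ → ℤˣ, s.sup' hs (fun i => |⟪W i (signVec ξ + signVec (η * ξ)),
        V i (signVec ξ - signVec (η * ξ))⟫|) ≤
      4 * D * maxFactor N * (1 + 4 * D' * maxFactor N) := by
  have hD0 : 0 ≤ D := by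
    obtain ⟨i, hi⟩ := hs
    exact (norm_nonneg _).trans (hW i hi)
  have hL := maxFactor_nonneg N
  refine (expect_sup_abs_decoupled_le hs hN W V hW η).trans ?_
  refine mul_le_mul_of_nonneg_left ?_ (by positivity)
  exact expect_sup_norm_map_signVec_le hs hN V zero_le_one hD (by simpa using hV)

lemma expect_sup_abs_decoupled_symm_le_of_hsNormSq_le {ι : Type*} {s : Finset ι}
    (hs : s.Nonempty)
    {N : ℕ} (hN : s.card ≤ N) (W V : ι → EuclideanSpace ℝ κ →L[ℝ] H) {D D' : ℝ}
    (hW : ∀ i ∈ s, ‖W i‖ ≤ D) (hD : ∀ i ∈ s, ‖V i‖ ≤ D') (hV : ∀ i ∈ s, hsNormSq (V i) ≤ 1)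
    (η : κ → ℤˣ) :
    𝔼 ξ : κ → ℤˣ, s.sup' hs (fun i => |⟪V i (signVec ξ + signVec (η * ξ)),
        W i (signVec ξ - signVec (η * ξ))⟫|) ≤
      4 * D * maxFactor N * (1 + 4 * D' * maxFactor N) := by
  -- Replacing `η` by `-η` exchanges the two vectors.
  have h : ∀ ξ : κ → ℤˣ, signVec (-η * ξ) = - signVec (η * ξ) := by
    intro ξ
    ext k
    simp
  have := expect_sup_abs_decoupled_le_of_hsNormSq_le hs hN W V hW hD hV (-η)
  simp only [h, sub_neg_eq_add, ← sub_eq_add_neg] at this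
  simpa only [real_inner_comm] using this

/-- One step of the chain: passing from the points of `s` to their approximants. -/
lemma expect_sup_abs_chaos_le_add {X : Type*} [DecidableEq X] {s t : Finset X} (hs : s.Nonempty)
    (ht : t.Nonempty) {N : ℕ} (hN : s.card ≤ N) (V : X → EuclideanSpace ℝ κ →L[ℝ] H) (q : X → X)
    (hq : ∀ x ∈ s, q x ∈ t) {D D' : ℝ} (hst : ∀ x ∈ s, ‖V x - V (q x)‖ ≤ D)
    (hsD : ∀ x ∈ s, ‖V x‖ ≤ D') (htD : ∀ x ∈ t, ‖V x‖ ≤ D')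
    (hs1 : ∀ x ∈ s, hsNormSq (V x) ≤ 1) (ht1 : ∀ x ∈ t, hsNormSq (V x) ≤ 1) (η : κ → ℤˣ) :
    𝔼 ξ : κ → ℤˣ, s.sup' hs (fun x => |⟪V x (signVec ξ + signVec (η * ξ)),
        V x (signVec ξ - signVec (η * ξ))⟫|) ≤
      (𝔼 ξ : κ → ℤˣ, t.sup' ht (fun x => |⟪V x (signVec ξ + signVec (η * ξ)),
        V x (signVec ξ - signVec (η * ξ))⟫|)) +
      8 * D * maxFactor N * (1 + 4 * D' * maxFactor N) := by
  have h1 := expect_sup_abs_decoupled_le_of_hsNormSq_le hs hN (fun x => V x - V (q x)) V hst hsD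
    hs1 η
  have h2 := expect_sup_abs_decoupled_symm_le_of_hsNormSq_le hs hN (fun x => V x - V (q x))
    (fun x => V (q x)) hst (fun x hx => htD _ (hq x hx)) (fun x hx => ht1 _ (hq x hx)) η
  have h3 := add_le_add h1 h2
  rw [← Finset.expect_add_distrib] at h3
  have h4 := add_le_add_right h3 (𝔼 ξ : κ → ℤˣ, t.sup' ht (fun x =>
    |⟪V x (signVec ξ + signVec (η * ξ)), V x (signVec ξ - signVec (η * ξ))⟫|))
  refine le_trans ?_ (h4.trans (le_of_eq (by ring)))
  rw [← Finset.expect_add_distrib]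
  refine Finset.expect_le_expect fun ξ _ => Finset.sup'_le _ _ fun x hx => ?_
  have e1 := Finset.le_sup' (fun x => |⟪V x (signVec ξ + signVec (η * ξ)),
        V x (signVec ξ - signVec (η * ξ))⟫|) (hq x hx)
  have e2 := Finset.le_sup' (fun x => |⟪(V x - V (q x)) (signVec ξ + signVec (η * ξ)),
        V x (signVec ξ - signVec (η * ξ))⟫|) hx
  have e3 := Finset.le_sup' (fun x => |⟪V (q x) (signVec ξ + signVec (η * ξ)),
        (V x - V (q x)) (signVec ξ - signVec (η * ξ))⟫|) hx
  refine le_trans ?_ (add_le_add e1 (add_le_add e2 e3))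
  set a := signVec ξ + signVec (η * ξ)
  set b := signVec ξ - signVec (η * ξ)
  have : (⟪V x a, V x b⟫ : ℝ) = ⟪V (q x) a, V (q x) b⟫ + (⟪(V x - V (q x)) a, V x b⟫ +
      ⟪V (q x) a, (V x - V (q x)) b⟫) := by
    simp only [sub_apply, inner_sub_left, inner_sub_right]
    ring
  rw [this]
  exact (abs_add_le _ _).trans (add_le_add_right (abs_add_le _ _) _)

/-- Chaining bound for the chaos `‖V x ξ‖² - 𝔼 ‖V x ξ‖²`, along successive approximating sets
`s 0, s 1, …, s J`, the last of which is approximated by the zero operator. -/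
theorem expect_sup_chaos_le_sum {X : Type*} [DecidableEq X] (s : ℕ → Finset X)
    (hs : ∀ j, (s j).Nonempty) (N : ℕ → ℕ) (J : ℕ) (hN : ∀ j ≤ J, (s j).card ≤ N j)
    (V : X → EuclideanSpace ℝ κ →L[ℝ] H) (q : ℕ → X → X)
    (hq : ∀ j < J, ∀ x ∈ s j, q j x ∈ s (j + 1)) (D : ℕ → ℝ) {D' : ℝ}
    (hD : ∀ j < J, ∀ x ∈ s j, ‖V x - V (q j x)‖ ≤ D j) (hJ : D' ≤ D J)
    (hD' : ∀ j ≤ J, ∀ x ∈ s j, ‖V x‖ ≤ D') (h1 : ∀ j ≤ J, ∀ x ∈ s j, hsNormSq (V x) ≤ 1) :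
    𝔼 ξ : κ → ℤˣ, (s 0).sup' (hs 0) (fun x => |‖V x (signVec ξ)‖ ^ 2 - hsNormSq (V x)|) ≤
      ∑ j ∈ Finset.range (J + 1),
        8 * D j * maxFactor (N j) * (1 + 4 * D' * maxFactor (N j)) := by
  refine expect_sup_abs_norm_sq_sub_le (hs 0) V fun η => ?_
  have hD'0 : 0 ≤ D' := by
    obtain ⟨x, hx⟩ := hs 0
    exact (norm_nonneg _).trans (hD' 0 J.zero_le x hx)
  have key : ∀ j ≤ J, 𝔼 ξ : κ → ℤˣ, (s 0).sup' (hs 0) (fun x =>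
      |⟪V x (signVec ξ + signVec (η * ξ)), V x (signVec ξ - signVec (η * ξ))⟫|) ≤
      (∑ j ∈ Finset.range j, 8 * D j * maxFactor (N j) * (1 + 4 * D' * maxFactor (N j))) +
      𝔼 ξ : κ → ℤˣ, (s j).sup' (hs j) (fun x =>
        |⟪V x (signVec ξ + signVec (η * ξ)), V x (signVec ξ - signVec (η * ξ))⟫|) := by
    intro j
    induction j with
    | zero => simp
    | succ j ih =>
      intro hj
      have h := expect_sup_abs_chaos_le_add (hs j) (hs (j + 1)) (hN j (by omega)) V (q j)
        (hq j hj) (hD j hj) (hD' j (by omega)) (hD' (j + 1) hj) (h1 j (by omega)) (h1 (j + 1) hj) η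
      have h' := ih (by omega)
      rw [Finset.sum_range_succ]
      linarith
  refine (key J le_rfl).trans ?_
  rw [Finset.sum_range_succ]
  refine add_le_add_right ?_ _
  refine (expect_sup_abs_decoupled_le_of_hsNormSq_le (hs J) (hN J le_rfl) V V (hD' J le_rfl)
    (hD' J le_rfl) (h1 J le_rfl) η).trans ?_
  have hL := maxFactor_nonneg (N J)
  refine mul_le_mul_of_nonneg_right ?_ (by positivity)
  refine mul_le_mul_of_nonneg_right ?_ hL
  linarith

end

/-! ### Fourier analysis of partial convolution operators -/

section

variable {G : Type*} [AddCommGroup G] [Fintype G]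

/-- The Fourier coefficient of a real function on a finite abelian group at a character. -/
noncomputable def fourierCoeffAt (x : G → ℝ) (ψ : AddChar G ℂ) : ℂ := ∑ j, (x j : ℂ) * ψ j

lemma norm_fourierCoeffAt_le (x : G → ℝ) (ψ : AddChar G ℂ) :
    ‖fourierCoeffAt x ψ‖ ≤ ∑ j, |x j| := by
  refine (norm_sum_le _ _).trans (Finset.sum_le_sum fun j _ => ?_)
  simp

lemma fourierCoeffAt_conv (x ξ : G → ℝ) (ψ : AddChar G ℂ) :
    fourierCoeffAt (fun i => ∑ k, x (i - k) * ξ k) ψ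
      = fourierCoeffAt x ψ * fourierCoeffAt ξ ψ := by
  simp only [fourierCoeffAt, Complex.ofReal_sum, Complex.ofReal_mul, Finset.sum_mul,
    Finset.mul_sum]
  rw [Finset.sum_comm]
  refine Finset.sum_congr rfl fun k _ => ?_
  rw [← (Equiv.subRight k).sum_comp fun i => (x i : ℂ) * ψ i * ((ξ k : ℂ) * ψ k)]
  refine Finset.sum_congr rfl fun i _ => ?_
  have : ψ i = ψ (i - k) * ψ k := by rw [← AddChar.map_add_eq_mul, sub_add_cancel]
  rw [this, Equiv.subRight_apply]
  ring

/-- Parseval's identity. -/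
lemma sum_norm_fourierCoeffAt_sq (x : G → ℝ) :
    ∑ ψ : AddChar G ℂ, ‖fourierCoeffAt x ψ‖ ^ 2 = Fintype.card G * ∑ j, x j ^ 2 := by
  classical
  have h : ∀ ψ : AddChar G ℂ, ((‖fourierCoeffAt x ψ‖ ^ 2 : ℝ) : ℂ)
      = ∑ j, ∑ l, (x j : ℂ) * x l * ψ (j - l) := by
    intro ψ
    rw [Complex.ofReal_pow, ← Complex.mul_conj', fourierCoeffAt, map_sum, Finset.sum_mul_sum]
    refine Finset.sum_congr rfl fun j _ => Finset.sum_congr rfl fun l _ => ?_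
    rw [map_mul, Complex.conj_ofReal, sub_eq_add_neg, AddChar.map_add_eq_mul,
      AddChar.map_neg_eq_conj]
    ring
  have : ((∑ ψ : AddChar G ℂ, ‖fourierCoeffAt x ψ‖ ^ 2 : ℝ) : ℂ)
      = ((Fintype.card G * ∑ j, x j ^ 2 : ℝ) : ℂ) := by
    rw [Complex.ofReal_sum]
    simp only [h]
    rw [Finset.sum_comm]
    simp only [Finset.sum_comm (s := (Finset.univ : Finset (AddChar G ℂ))), ← Finset.mul_sum,
      AddChar.sum_apply_eq_ite, sub_eq_zero]
    simp [Finset.mul_sum]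
    refine Finset.sum_congr rfl fun j _ => ?_
    ring
  exact_mod_cast this

/-- Convolution by `x` has `ℓ²`-operator norm at most the supremum of the Fourier transform. -/
lemma sum_conv_sq_le (x ξ : G → ℝ) {u : ℝ} (hx : ∀ ψ, ‖fourierCoeffAt x ψ‖ ≤ u) :
    ∑ i, (∑ k, x (i - k) * ξ k) ^ 2 ≤ u ^ 2 * ∑ k, ξ k ^ 2 := by
  have hG : (0 : ℝ) < Fintype.card G := by exact_mod_cast Fintype.card_pos
  refine le_of_mul_le_mul_left ?_ hG
  rw [← sum_norm_fourierCoeffAt_sq, mul_left_comm, ← sum_norm_fourierCoeffAt_sq, Finset.mul_sum]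
  refine Finset.sum_le_sum fun ψ _ => ?_
  rw [fourierCoeffAt_conv, norm_mul, mul_pow]
  have := hx ψ
  gcongr

end

section

variable {n : ℕ} (Ω : Finset (Fin n))

/-- The operator `ξ ↦ m^{-1/2} R_Ω (x * ξ)`, obtained from the partial circulant matrix by
exchanging the roles of the generator and the argument. -/
noncomputable def partialConv (x : Fin n → ℝ) :
    EuclideanSpace ℝ (Fin n) →L[ℝ] EuclideanSpace ℝ Ω :=
  LinearMap.toContinuousLinearMap (Matrix.toLpLin 2 2
    ((1 / √(Ω.card : ℝ)) • (Matrix.of fun (i : Ω) (k : Fin n) => x (i - k))))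

lemma partialConv_apply (x : Fin n → ℝ) (ξ : EuclideanSpace ℝ (Fin n)) (i : Ω) :
    partialConv Ω x ξ i = 1 / √(Ω.card : ℝ) * ∑ k, x (i - k) * ξ k := by
  simp [partialConv, Matrix.mulVec, dotProduct, Finset.mul_sum, mul_assoc]

lemma partialConv_sub (x y : Fin n → ℝ) :
    partialConv Ω x - partialConv Ω y = partialConv Ω (x - y) := by
  ext ξ i
  simp [partialConv_apply, sub_mul, mul_sub]

lemma partialCirculant_mulVec_apply (φ x : Fin n → ℝ) (i : Ω) :
    (partialCirculant Ω φ *ᵥ x) i = 1 / √(Ω.card : ℝ) * ∑ j, φ (i - j) * x j := by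
  simp [partialCirculant, restrictionMatrix, Matrix.mulVec, dotProduct, Matrix.mul_apply,
    Matrix.circulant_apply, Finset.mul_sum, mul_assoc]

variable [NeZero n]

lemma toLp_partialCirculant_mulVec (x : Fin n → ℝ) (ξ : Fin n → ℤˣ) :
    WithLp.toLp 2 (partialCirculant Ω (fun k => ((ξ k : ℤ) : ℝ)) *ᵥ x)
      = partialConv Ω x (signVec ξ) := by
  ext i
  rw [partialConv_apply]
  simp only [partialCirculant_mulVec_apply]
  congr 1
  rw [← (Equiv.subLeft (i : Fin n)).sum_comp fun k => x (i - k) * signVec ξ k]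
  refine Finset.sum_congr rfl fun j _ => ?_
  simp [mul_comm]

lemma hsNormSq_partialConv (hΩ : Ω.Nonempty) (x : Fin n → ℝ) :
    hsNormSq (partialConv Ω x) = ∑ j, x j ^ 2 := by
  have hm : (0 : ℝ) < Ω.card := by exact_mod_cast hΩ.card_pos
  have h : ∀ k, ‖partialConv Ω x (EuclideanSpace.single k 1)‖ ^ 2
      = 1 / (Ω.card : ℝ) * ∑ i : Ω, x (i - k) ^ 2 := by
    intro k
    rw [EuclideanSpace.norm_sq_eq, Finset.mul_sum]
    refine Finset.sum_congr rfl fun i _ => ?_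
    rw [Real.norm_eq_abs, sq_abs, partialConv_apply, mul_pow, div_pow, Real.sq_sqrt hm.le]
    simp
  simp only [hsNormSq, h]
  rw [← Finset.mul_sum, Finset.sum_comm]
  have h2 : ∀ i : Fin n, ∑ k, x (i - k) ^ 2 = ∑ j, x j ^ 2 := fun i =>
    (Equiv.subLeft i).sum_comp fun j => x j ^ 2
  simp only [h2]
  simp
  field_simp

lemma norm_partialConv_le (x : Fin n → ℝ) {u : ℝ} (hx : ∀ ψ, ‖fourierCoeffAt x ψ‖ ≤ u) :
    ‖partialConv Ω x‖ ≤ u / √(Ω.card : ℝ) := by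
  have hu : 0 ≤ u := (norm_nonneg _).trans (hx 1)
  refine ContinuousLinearMap.opNorm_le_bound _ (by positivity) fun ξ => ?_
  refine abs_le_of_sq_le_sq' ?_ (by positivity) |>.2
  calc ‖partialConv Ω x ξ‖ ^ 2
      = 1 / √(Ω.card : ℝ) ^ 2 * ∑ i : Ω, (∑ k, x (i - k) * ξ k) ^ 2 := by
        rw [EuclideanSpace.norm_sq_eq, Finset.mul_sum]
        refine Finset.sum_congr rfl fun i _ => ?_
        rw [Real.norm_eq_abs, sq_abs, partialConv_apply, mul_pow, div_pow, one_pow]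
    _ ≤ 1 / √(Ω.card : ℝ) ^ 2 * ∑ i : Fin n, (∑ k, x (i - k) * ξ k) ^ 2 := by
        refine mul_le_mul_of_nonneg_left ?_ (by positivity)
        rw [Finset.sum_coe_sort Ω (fun i => (∑ k, x (i - k) * ξ k) ^ 2)]
        exact Finset.sum_le_univ_sum_of_nonneg fun i => sq_nonneg _
    _ ≤ 1 / √(Ω.card : ℝ) ^ 2 * (u ^ 2 * ∑ k, ξ k ^ 2) := by
        refine mul_le_mul_of_nonneg_left (sum_conv_sq_le x ξ hx) (by positivity)
    _ = (u / √(Ω.card : ℝ) * ‖ξ‖) ^ 2 := by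
        rw [mul_pow, EuclideanSpace.norm_sq_eq]
        simp only [Real.norm_eq_abs, sq_abs]
        ring

end

/-! ### Maurey's empirical method -/

/-- Hoeffding's lemma for finitely supported weights. -/
lemma sum_mul_exp_le_exp_sq {α : Type*} [Fintype α] {w t : α → ℝ} (hw : ∀ a, 0 ≤ w a)
    (hw1 : ∑ a, w a = 1) (ht : ∑ a, w a * t a = 0) {B : ℝ} (hB : 0 < B) (htB : ∀ a, |t a| ≤ B) :
    ∑ a, w a * Real.exp (t a) ≤ Real.exp (B ^ 2 / 2) := by
  have hconv : ∀ a, Real.exp (t a) ≤ Real.cosh B + t a * (Real.sinh B / B) := by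
    intro a
    obtain ⟨h1, h2⟩ := abs_le.1 (htB a)
    have := convexOn_exp.2 (Set.mem_univ (-B)) (Set.mem_univ B)
      (show 0 ≤ (B - t a) / (2 * B) from div_nonneg (by linarith) (by positivity))
      (show 0 ≤ (B + t a) / (2 * B) from div_nonneg (by linarith) (by positivity))
      (by field_simp; ring)
    simp only [smul_eq_mul] at this
    have e : (B - t a) / (2 * B) * -B + (B + t a) / (2 * B) * B = t a := by field_simp; ring
    rw [e] at this
    refine this.trans (le_of_eq ?_)
    rw [Real.cosh_eq, Real.sinh_eq]
    field_simp
    ring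
  calc ∑ a, w a * Real.exp (t a) ≤ ∑ a, w a * (Real.cosh B + t a * (Real.sinh B / B)) :=
        Finset.sum_le_sum fun a _ => mul_le_mul_of_nonneg_left (hconv a) (hw a)
    _ = (∑ a, w a) * Real.cosh B + (∑ a, w a * t a) * (Real.sinh B / B) := by
        rw [Finset.sum_mul, Finset.sum_mul, ← Finset.sum_add_distrib]
        exact Finset.sum_congr rfl fun a _ => by ring
    _ = Real.cosh B := by rw [hw1, ht]; ring
    _ ≤ _ := Real.cosh_le_exp_half_sq B

/-- A quantity is at most its weighted average at some point. -/
lemma exists_le_of_sum_weight_mul_le {α : Type*} [Fintype α] {w g : α → ℝ} (hw : ∀ a, 0 ≤ w a)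
    (hw1 : ∑ a, w a = 1) {C : ℝ} (h : ∑ a, w a * g a ≤ C) : ∃ a, g a ≤ C := by
  by_contra! hcon
  have h0 : ∑ a, w a * (g a - C) ≤ 0 := by
    simp only [mul_sub, Finset.sum_sub_distrib, ← Finset.sum_mul, hw1]
    linarith
  have hnn : ∀ a ∈ Finset.univ, 0 ≤ w a * (g a - C) := fun a _ =>
    mul_nonneg (hw a) (sub_nonneg.2 (hcon a).le)
  have hz := (Finset.sum_eq_zero_iff_of_nonneg hnn).1 (le_antisymm h0 (Finset.sum_nonneg hnn))
  have : ∑ a, w a = 0 := Finset.sum_eq_zero fun a ha => by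
    rcases mul_eq_zero.1 (hz a ha) with h | h
    · exact h
    · linarith [hcon a]
  linarith

/-- Maurey's empirical method in derandomized form: a convex combination is approximated,
simultaneously for all functionals in a finite family, by an average of `K` atoms. The atoms are
chosen one at a time so that a sum of exponentials of the errors grows as little as possible. -/
lemma exists_average_approx {α Λ : Type*} [Fintype α] [Fintype Λ] [Nonempty Λ] {w : α → ℝ}
    (hw : ∀ a, 0 ≤ w a) (hw1 : ∑ a, w a = 1) (g : Λ → α → ℝ) {ρ : ℝ} (hρ : 0 < ρ)
    (hg : ∀ v a, |g v a| ≤ ρ) {K : ℕ} (hK : 0 < K) :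
    ∃ f : Fin K → α, ∀ v, |∑ i, g v (f i) - K * ∑ a, w a * g v a| ≤
      2 * ρ * √K * maxFactor (Fintype.card Λ) := by
  set h : Λ → α → ℝ := fun v a => g v a - ∑ a, w a * g v a with hh
  have hmean : ∀ v, |∑ a, w a * g v a| ≤ ρ := by
    intro v
    calc |∑ a, w a * g v a| ≤ ∑ a, |w a * g v a| := Finset.abs_sum_le_sum_abs _ _
      _ ≤ ∑ a, w a * ρ := Finset.sum_le_sum fun a _ => by
          rw [abs_mul, abs_of_nonneg (hw a)]
          exact mul_le_mul_of_nonneg_left (hg v a) (hw a)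
      _ = ρ := by rw [← Finset.sum_mul, hw1, one_mul]
  have hb : ∀ v a, |h v a| ≤ 2 * ρ := by
    intro v a
    have h1 := abs_sub (g v a) (∑ a, w a * g v a)
    have h2 := hg v a
    have h3 := hmean v
    simp only [hh]
    linarith
  have h0 : ∀ v, ∑ a, w a * h v a = 0 := by
    intro v
    simp only [hh, mul_sub, Finset.sum_sub_distrib, ← Finset.sum_mul, hw1]
    ring
  have hK' : (0 : ℝ) < K := by exact_mod_cast hK
  have hΛ : (1 : ℝ) ≤ Fintype.card Λ := by exact_mod_cast Fintype.card_pos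
  have hlog : 0 < Real.log (2 * Fintype.card Λ) := Real.log_pos (by linarith)
  set L := maxFactor (Fintype.card Λ) with hLdef
  have hL : 0 < L := Real.sqrt_pos.2 (by positivity)
  have hLsq : L ^ 2 = 2 * Real.log (2 * Fintype.card Λ) := Real.sq_sqrt (by positivity)
  have hsK : 0 < √(K : ℝ) := Real.sqrt_pos.2 hK'
  have hsK2 : √(K : ℝ) ^ 2 = K := Real.sq_sqrt hK'.le
  set l : ℝ := L / (√K * (2 * ρ)) with hl
  have hlpos : 0 < l := by positivity
  have pot : ∀ k : ℕ, ∃ f : Fin k → α,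
      ∑ v, (Real.exp (l * ∑ i, h v (f i)) + Real.exp (-l * ∑ i, h v (f i))) ≤
        2 * Fintype.card Λ * Real.exp (k * ((l * (2 * ρ)) ^ 2 / 2)) := by
    intro k
    induction k with
    | zero =>
      refine ⟨Fin.elim0, ?_⟩
      simp
      linarith
    | succ k ih =>
      obtain ⟨f, hf⟩ := ih
      have havg : ∑ a, w a * ∑ v, (Real.exp (l * ∑ i, h v ((Fin.cons a f : Fin (k + 1) → α) i))
          + Real.exp (-l * ∑ i, h v ((Fin.cons a f : Fin (k + 1) → α) i))) ≤
          2 * Fintype.card Λ * Real.exp ((k + 1 : ℕ) * ((l * (2 * ρ)) ^ 2 / 2)) := by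
        have hE : ∀ v (l' : ℝ), |l'| = l →
            ∑ a, w a * Real.exp (l' * h v a) ≤ Real.exp ((l * (2 * ρ)) ^ 2 / 2) := by
          intro v l' hl'
          refine sum_mul_exp_le_exp_sq hw hw1 ?_ (by positivity) fun a => ?_
          · simp only [mul_left_comm _ l', ← Finset.mul_sum, h0, mul_zero]
          · rw [abs_mul, hl']
            exact mul_le_mul_of_nonneg_left (hb v a) hlpos.le
        calc _ = ∑ v, (Real.exp (l * ∑ i, h v (f i)) * ∑ a, w a * Real.exp (l * h v a) +
                Real.exp (-l * ∑ i, h v (f i)) * ∑ a, w a * Real.exp (-l * h v a)) := by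
              simp only [Fin.sum_univ_succ, Fin.cons_zero, Fin.cons_succ, mul_add, Real.exp_add,
                Finset.mul_sum, Finset.sum_add_distrib]
              rw [Finset.sum_comm, Finset.sum_comm (γ := α)]
              congr 1 <;> exact Finset.sum_congr rfl fun _ _ => Finset.sum_congr rfl fun _ _ => by
                ring
          _ ≤ ∑ v, (Real.exp (l * ∑ i, h v (f i)) * Real.exp ((l * (2 * ρ)) ^ 2 / 2) +
                Real.exp (-l * ∑ i, h v (f i)) * Real.exp ((l * (2 * ρ)) ^ 2 / 2)) := by
              refine Finset.sum_le_sum fun v _ => add_le_add ?_ ?_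
              · exact mul_le_mul_of_nonneg_left (hE v l (abs_of_pos hlpos)) (Real.exp_pos _).le
              · exact mul_le_mul_of_nonneg_left (hE v (-l) (by rw [abs_neg, abs_of_pos hlpos]))
                  (Real.exp_pos _).le
          _ = (∑ v, (Real.exp (l * ∑ i, h v (f i)) + Real.exp (-l * ∑ i, h v (f i)))) *
                Real.exp ((l * (2 * ρ)) ^ 2 / 2) := by
              rw [Finset.sum_mul]
              exact Finset.sum_congr rfl fun _ _ => by ring
          _ ≤ 2 * Fintype.card Λ * Real.exp (k * ((l * (2 * ρ)) ^ 2 / 2)) *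
                Real.exp ((l * (2 * ρ)) ^ 2 / 2) :=
              mul_le_mul_of_nonneg_right hf (Real.exp_pos _).le
          _ = _ := by
              rw [mul_assoc, ← Real.exp_add]
              push_cast
              ring_nf
      obtain ⟨a, ha⟩ := exists_le_of_sum_weight_mul_le hw hw1 havg
      exact ⟨Fin.cons a f, ha⟩
  obtain ⟨f, hf⟩ := pot K
  refine ⟨f, fun v => ?_⟩
  have hsum : ∑ i, g v (f i) - K * ∑ a, w a * g v a = ∑ i, h v (f i) := by
    simp [hh, Finset.sum_sub_distrib]
  rw [hsum]
  have h1 := (Finset.single_le_sum (f := fun v => Real.exp (l * ∑ i, h v (f i)) +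
    Real.exp (-l * ∑ i, h v (f i))) (fun v _ => by positivity) (Finset.mem_univ v)).trans hf
  have h2 : Real.exp (l * |∑ i, h v (f i)|) ≤
      Real.exp (l * ∑ i, h v (f i)) + Real.exp (-l * ∑ i, h v (f i)) := by
    have p1 := Real.exp_pos (l * ∑ i, h v (f i))
    have p2 := Real.exp_pos (-l * ∑ i, h v (f i))
    rcases abs_cases (∑ i, h v (f i)) with ⟨h, _⟩ | ⟨h, _⟩
    · rw [h]; linarith
    · rw [h, mul_neg, ← neg_mul]; linarith
  have h3 : l * |∑ i, h v (f i)| ≤ L ^ 2 := by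
    have h4 := Real.log_le_log (Real.exp_pos _) (h2.trans h1)
    rw [Real.log_exp, Real.log_mul (by positivity) (Real.exp_ne_zero _), Real.log_exp] at h4
    refine h4.trans (le_of_eq ?_)
    have e : l * (2 * ρ) = L / √K := by rw [hl]; field_simp
    rw [e, div_pow, hsK2, hLsq]
    field_simp
    ring
  rw [hl, div_mul_eq_mul_div, div_le_iff₀ (by positivity)] at h3
  have : L * |∑ i, h v (f i)| ≤ L * (2 * ρ * √K * L) := by nlinarith
  exact le_of_mul_le_mul_left this hL

/-- Maurey's lemma for the `ℓ¹`-ball of radius `ρ`, the convex hull of the points `± ρ eⱼ`. -/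
lemma exists_signed_average_approx {κ Λ : Type*} [Fintype κ] [Nonempty κ] [Fintype Λ] [Nonempty Λ]
    (e : Λ → κ → ℝ) (he : ∀ v j, |e v j| ≤ 1) {x : κ → ℝ} {ρ : ℝ} (hρ : 0 < ρ)
    (hx : ∑ j, |x j| ≤ ρ) {K : ℕ} (hK : 0 < K) :
    ∃ f : Fin K → κ × ℤˣ, ∀ v,
      |∑ i, ρ * (((f i).2 : ℤ) : ℝ) * e v (f i).1 - K * ∑ j, x j * e v j| ≤
        2 * ρ * √K * maxFactor (Fintype.card Λ) := by
  have hκ : (0 : ℝ) < Fintype.card κ := by exact_mod_cast Fintype.card_pos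
  set d : ℝ := (1 - (∑ j, |x j|) / ρ) / (2 * Fintype.card κ) with hd
  have hd0 : 0 ≤ d := div_nonneg (sub_nonneg.2 ((div_le_one hρ).2 hx)) (by positivity)
  set w : κ × ℤˣ → ℝ := fun a => (|x a.1| + ((a.2 : ℤ) : ℝ) * x a.1) / (2 * ρ) + d with hw
  have hsum2 : ∀ F : κ × ℤˣ → ℝ, ∑ a, F a = ∑ j, (F (j, 1) + F (j, -1)) := by
    intro F
    rw [Fintype.sum_prod_type]
    refine Finset.sum_congr rfl fun j _ => ?_
    have : (Finset.univ : Finset ℤˣ) = {1, -1} := rfl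
    simp [this]
  have hw0 : ∀ a, 0 ≤ w a := by
    rintro ⟨j, u⟩
    refine add_nonneg (div_nonneg ?_ (by positivity)) hd0
    rcases Int.units_eq_one_or u with rfl | rfl
    · have := neg_abs_le (x j)
      simp; linarith
    · have := le_abs_self (x j)
      simp; linarith
  have hw1 : ∑ a, w a = 1 := by
    rw [hsum2]
    have : ∀ j, w (j, 1) + w (j, -1) = |x j| / ρ + 2 * d := by
      intro j
      simp [hw]
      field_simp
      ring
    simp only [this, Finset.sum_add_distrib, ← Finset.sum_div, Finset.sum_const, nsmul_eq_mul,
      Finset.card_univ]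
    rw [hd]
    field_simp
    ring
  obtain ⟨f, hf⟩ := exists_average_approx hw0 hw1
    (fun v a => ρ * ((a.2 : ℤ) : ℝ) * e v a.1) hρ (fun v a => by
      rw [abs_mul, abs_mul, abs_of_pos hρ]
      have : |((a.2 : ℤ) : ℝ)| = 1 := by
        rcases Int.units_eq_one_or a.2 with h | h <;> simp [h]
      rw [this, mul_one]
      exact mul_le_of_le_one_right hρ.le (he v a.1)) hK
  refine ⟨f, fun v => ?_⟩
  have : ∑ a, w a * (ρ * ((a.2 : ℤ) : ℝ) * e v a.1) = ∑ j, x j * e v j := by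
    rw [hsum2]
    refine Finset.sum_congr rfl fun j _ => ?_
    simp [hw]
    field_simp
    ring
  rw [← this]
  exact hf v

/-- Replacing each point by a fixed representative with the same code. -/
lemma exists_representative {X β : Type*} [DecidableEq X] [Fintype β] (T : Finset X)
    (code : X → β) :
    ∃ q : X → X, (∀ x ∈ T, q x ∈ T ∧ code (q x) = code x) ∧
      (T.image q).card ≤ Fintype.card β := by
  classical
  set q : X → X := fun x => if h : ∃ y ∈ T, code y = code x then h.choose else x with hq
  have hqT : ∀ x ∈ T, q x ∈ T ∧ code (q x) = code x := by
    intro x hx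
    have h : ∃ y ∈ T, code y = code x := ⟨x, hx, rfl⟩
    have : q x = h.choose := by simp only [hq]; rw [dif_pos h]
    rw [this]
    exact h.choose_spec
  refine ⟨q, hqT, ?_⟩
  refine Finset.card_le_card_of_injOn code (fun _ _ => Finset.mem_univ _) ?_
  intro y hy z hz hyz
  obtain ⟨x, hx, rfl⟩ := Finset.mem_image.1 hy
  obtain ⟨x', hx', rfl⟩ := Finset.mem_image.1 hz
  rw [(hqT x hx).2, (hqT x' hx').2] at hyz
  simp only [hq, hyz]
  have h : ∃ y ∈ T, code y = code x' := ⟨x', hx', rfl⟩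
  rw [dif_pos h, dif_pos h]

/-- Covering numbers of subsets of the `ℓ¹`-ball in the supremum norm of the Fourier transform:
`(2n)^K` points of the set suffice at scale `8 ρ √(2 log (4n)) / √K`. -/
lemma exists_fourier_net {G : Type*} [AddCommGroup G] [Fintype G] [DecidableEq (G → ℝ)]
    (T : Finset (G → ℝ)) {ρ : ℝ} (hρ : 0 < ρ) (hT : ∀ x ∈ T, ∑ j, |x j| ≤ ρ) {K : ℕ}
    (hK : 0 < K) :
    ∃ q : (G → ℝ) → (G → ℝ), (∀ x ∈ T, q x ∈ T) ∧
      (T.image q).card ≤ (2 * Fintype.card G) ^ K ∧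
      ∀ x ∈ T, ∀ ψ, ‖fourierCoeffAt (x - q x) ψ‖ ≤
        8 * ρ * maxFactor (2 * Fintype.card G) / √K := by
  set e : AddChar G ℂ × Bool → G → ℝ := fun v j => if v.2 then (v.1 j).re else (v.1 j).im with he
  have he1 : ∀ v j, |e v j| ≤ 1 := by
    rintro ⟨ψ, b⟩ j
    have h := ψ.norm_apply j
    cases b
    · exact (Complex.abs_im_le_norm _).trans h.le
    · exact (Complex.abs_re_le_norm _).trans h.le
  have hcard : Fintype.card (AddChar G ℂ × Bool) = 2 * Fintype.card G := by
    rw [Fintype.card_prod, AddChar.card_eq, Fintype.card_bool, mul_comm]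
  have hex : ∀ x ∈ T, ∃ f : Fin K → G × ℤˣ, ∀ v,
      |∑ i, ρ * (((f i).2 : ℤ) : ℝ) * e v (f i).1 - K * ∑ j, x j * e v j| ≤
        2 * ρ * √K * maxFactor (2 * Fintype.card G) := by
    intro x hx
    rw [← hcard]
    exact exists_signed_average_approx e he1 hρ (hT x hx) hK
  classical
  set code : (G → ℝ) → (Fin K → G × ℤˣ) := fun x =>
    if hx : x ∈ T then (hex x hx).choose else fun _ => (0, 1) with hcode
  have hcodeT : ∀ x ∈ T, ∀ v,
      |∑ i, ρ * (((code x i).2 : ℤ) : ℝ) * e v (code x i).1 - K * ∑ j, x j * e v j| ≤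
        2 * ρ * √K * maxFactor (2 * Fintype.card G) := by
    intro x hx
    have : code x = (hex x hx).choose := by simp only [hcode]; rw [dif_pos hx]
    rw [this]
    exact (hex x hx).choose_spec
  obtain ⟨q, hq, hqc⟩ := exists_representative T code
  refine ⟨q, fun x hx => (hq x hx).1, ?_, fun x hx ψ => ?_⟩
  · refine (le_of_eq_of_le (by congr!) hqc).trans (le_of_eq ?_)
    simp [mul_comm]
  have hK' : (0 : ℝ) < K := by exact_mod_cast hK
  have hsK : 0 < √(K : ℝ) := Real.sqrt_pos.2 hK'
  have hsK2 : √(K : ℝ) * √(K : ℝ) = K := Real.mul_self_sqrt hK'.le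
  have hv : ∀ v, |∑ j, (x - q x) j * e v j| ≤ 4 * ρ * maxFactor (2 * Fintype.card G) / √K := by
    intro v
    have h1 := hcodeT x hx v
    have h2 := hcodeT (q x) (hq x hx).1 v
    rw [(hq x hx).2] at h2
    have h3 : K * |∑ j, (x - q x) j * e v j| ≤
        4 * ρ * √K * maxFactor (2 * Fintype.card G) := by
      rw [← abs_of_pos hK', ← abs_mul, abs_of_pos hK']
      have : (K : ℝ) * ∑ j, (x - q x) j * e v j = K * ∑ j, x j * e v j - K * ∑ j, q x j * e v j := by
        simp only [Pi.sub_apply, sub_mul, Finset.sum_sub_distrib, mul_sub]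
      rw [this, abs_le]
      rw [abs_le] at h1 h2
      constructor <;> linarith [h1.1, h1.2, h2.1, h2.2]
    rw [le_div_iff₀ hsK]
    refine le_of_mul_le_mul_left ?_ hsK
    calc _ = √(K : ℝ) * √K * |∑ j, (x - q x) j * e v j| := by ring
      _ = K * |∑ j, (x - q x) j * e v j| := by rw [hsK2]
      _ ≤ _ := h3
      _ = _ := by ring
  have hre : (fourierCoeffAt (x - q x) ψ).re = ∑ j, (x - q x) j * e (ψ, true) j := by
    simp [fourierCoeffAt, he]
  have him : (fourierCoeffAt (x - q x) ψ).im = ∑ j, (x - q x) j * e (ψ, false) j := by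
    simp [fourierCoeffAt, he]
  refine (Complex.norm_le_abs_re_add_abs_im _).trans ?_
  rw [hre, him]
  refine (add_le_add (hv _) (hv _)).trans (le_of_eq (by ring))

/-! ### Restricted isometry constants and nets of sparse vectors -/

section

variable {κ : Type*} [Fintype κ]

lemma l2normSq_eq_sum (x : κ → ℝ) : l2normSq x = ∑ j, x j ^ 2 := by
  simp [l2normSq, EuclideanSpace.norm_sq_eq]

lemma l2normSq_smul (c : ℝ) (x : κ → ℝ) : l2normSq (c • x) = c ^ 2 * l2normSq x := by
  simp [l2normSq_eq_sum, mul_pow, Finset.mul_sum]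

lemma l0norm_eq_card (x : κ → ℝ) : l0norm x = (Finset.univ.filter fun j => x j ≠ 0).card := by
  rw [l0norm, Set.ncard_eq_toFinset_card']
  congr 1
  ext j
  simp

lemma l0norm_smul {c : ℝ} (hc : c ≠ 0) (x : κ → ℝ) : l0norm (c • x) = l0norm x := by
  simp [l0norm, hc]

lemma l0norm_le_card (x : κ → ℝ) : l0norm x ≤ Fintype.card κ := by
  rw [l0norm_eq_card]
  exact Finset.card_le_univ _

/-- For an `s`-sparse vector, `‖x‖₁ ≤ √s ‖x‖₂`. -/
lemma sum_abs_le_sqrt_of_l0norm_le {x : κ → ℝ} {s : ℕ} (hx : l0norm x ≤ s)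
    (hx1 : ∑ j, x j ^ 2 ≤ 1) : ∑ j, |x j| ≤ √s := by
  rw [l0norm_eq_card] at hx
  set S := Finset.univ.filter fun j => x j ≠ 0 with hS
  have h1 : ∑ j, |x j| = ∑ j ∈ S, |x j| := by
    refine (Finset.sum_subset (Finset.subset_univ _) fun j _ hj => ?_).symm
    simpa [hS] using hj
  rw [h1]
  refine Real.le_sqrt_of_sq_le ?_
  calc (∑ j ∈ S, |x j|) ^ 2 ≤ S.card * ∑ j ∈ S, |x j| ^ 2 := sq_sum_le_card_mul_sum_sq
    _ ≤ s * 1 := by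
        refine mul_le_mul (by exact_mod_cast hx) ?_ (Finset.sum_nonneg fun _ _ => by positivity)
          (by positivity)
        simp only [sq_abs]
        exact (Finset.sum_le_univ_sum_of_nonneg fun _ => sq_nonneg _).trans hx1
    _ = s := mul_one _

lemma abs_le_one_of_sum_sq_le {x : κ → ℝ} (hx1 : ∑ j, x j ^ 2 ≤ 1) (j : κ) : |x j| ≤ 1 := by
  rw [← sq_le_one_iff_abs_le_one]
  exact (Finset.single_le_sum (f := fun j => x j ^ 2) (fun _ _ => sq_nonneg _)
    (Finset.mem_univ j)).trans hx1

end

/-- Rounding of a real number towards zero to a multiple of `1 / n`. -/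
noncomputable def roundTowardsZero (n : ℕ) (t : ℝ) : ℝ :=
  (((if t < 0 then -1 else 1 : ℤˣ) : ℤ) : ℝ) * ((⌊n * |t|⌋₊ : ℕ) : ℝ) / n

lemma abs_roundTowardsZero_le {n : ℕ} (hn : 0 < n) (t : ℝ) : |roundTowardsZero n t| ≤ |t| := by
  have hn' : (0 : ℝ) < n := by exact_mod_cast hn
  have h : |roundTowardsZero n t| = ((⌊n * |t|⌋₊ : ℕ) : ℝ) / n := by
    rw [roundTowardsZero]
    split_ifs <;> simp [abs_div]
  rw [h, div_le_iff₀ hn', mul_comm |t|]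
  exact Nat.floor_le (by positivity)

lemma abs_sub_roundTowardsZero_le {n : ℕ} (hn : 0 < n) (t : ℝ) :
    |t - roundTowardsZero n t| ≤ 1 / n := by
  have hn' : (0 : ℝ) < n := by exact_mod_cast hn
  have h1 : ((⌊n * |t|⌋₊ : ℕ) : ℝ) / n ≤ |t| := by
    rw [div_le_iff₀ hn', mul_comm |t|]
    exact Nat.floor_le (by positivity)
  have h2 : |t| ≤ ((⌊n * |t|⌋₊ : ℕ) : ℝ) / n + 1 / n := by
    rw [← add_div, le_div_iff₀ hn', mul_comm |t|]
    exact (Nat.lt_floor_add_one _).le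
  rw [roundTowardsZero]
  split_ifs with h
  · rw [abs_of_neg h] at *
    rw [abs_le]
    simp only [Units.val_neg, Units.val_one, Int.cast_neg, Int.cast_one, neg_mul, one_mul, neg_div]
    constructor <;> linarith [one_div_pos.2 hn']
  · rw [abs_of_nonneg (not_lt.1 h)] at *
    rw [abs_le]
    simp only [Units.val_one, Int.cast_one, one_mul]
    constructor <;> linarith [one_div_pos.2 hn']

lemma roundTowardsZero_zero (n : ℕ) : roundTowardsZero n 0 = 0 := by
  simp [roundTowardsZero]

/-- A finite set of vectors in the intersection of the unit ball with `√s` times the `ℓ¹`-ball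
which contains a coordinatewise rounding of every `s`-sparse vector of the unit ball. -/
lemma exists_sparse_net {n : ℕ} [NeZero n] (s : ℕ) :
    ∃ T : Finset (Fin n → ℝ), T.Nonempty ∧ T.card ≤ (n * (2 * (n + 1))) ^ s ∧
      (∀ x ∈ T, ∑ j, x j ^ 2 ≤ 1 ∧ ∑ j, |x j| ≤ √s) ∧
      ∀ x : Fin n → ℝ, l0norm x ≤ s → ∑ j, x j ^ 2 ≤ 1 →
        ∃ y ∈ T, ∑ j, |x j - y j| ≤ (s : ℝ) / n := by
  classical
  have hn : 0 < n := Nat.pos_of_neZero n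
  have hn' : (0 : ℝ) < n := by exact_mod_cast hn
  set decode : (Fin s → Fin n × ℤˣ × Fin (n + 1)) → (Fin n → ℝ) := fun f j =>
    if h : ∃ i, (f i).1 = j then
      (((f h.choose).2.1 : ℤ) : ℝ) * ((f h.choose).2.2 : ℕ) / n else 0 with hdecode
  set T : Finset (Fin n → ℝ) := (Finset.univ.image decode).filter fun x =>
    ∑ j, x j ^ 2 ≤ 1 ∧ ∑ j, |x j| ≤ √s with hTdef
  have hnet : ∀ x : Fin n → ℝ, l0norm x ≤ s → ∑ j, x j ^ 2 ≤ 1 →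
        ∃ y ∈ T, ∑ j, |x j - y j| ≤ (s : ℝ) / n := by
    intro x hx hx1
    have hl1 := sum_abs_le_sqrt_of_l0norm_le hx hx1
    have hxs := hx
    rw [l0norm_eq_card] at hxs
    set S := Finset.univ.filter fun j => x j ≠ 0 with hS
    obtain ⟨e⟩ : Nonempty (S ↪ Fin s) := Function.Embedding.nonempty_of_card_le (by simpa using hxs)
    set g : Fin s → Fin n := Function.extend e Subtype.val (fun _ => 0) with hg
    have hgS : ∀ j ∈ S, ∃ i, g i = j := fun j hj => ⟨e ⟨j, hj⟩, e.injective.extend_apply _ _ _⟩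
    have hfl : ∀ j, ⌊n * |x j|⌋₊ < n + 1 := by
      intro j
      refine Nat.lt_succ_of_le (Nat.floor_le_of_le ?_)
      exact mul_le_of_le_one_right hn'.le (abs_le_one_of_sum_sq_le hx1 j)
    set f : Fin s → Fin n × ℤˣ × Fin (n + 1) := fun i =>
      (g i, if x (g i) < 0 then -1 else 1, ⟨⌊n * |x (g i)|⌋₊, hfl _⟩) with hf
    have hy : decode f = fun j => roundTowardsZero n (x j) := by
      funext j
      by_cases h : ∃ i, (f i).1 = j
      · have hc : g h.choose = j := h.choose_spec
        simp only [hdecode]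
        rw [dif_pos h]
        simp only [hf]
        rw [roundTowardsZero]
        simp only [hc]
      · have hj : x j = 0 := by
          by_contra hne
          exact h (hgS j (by simp [hS, hne]))
        simp only [hdecode]
        rw [dif_neg h, hj, roundTowardsZero_zero]
    refine ⟨decode f, ?_, ?_⟩
    · rw [hTdef, Finset.mem_filter]
      refine ⟨Finset.mem_image_of_mem _ (Finset.mem_univ _), ?_, ?_⟩
      · rw [hy]
        refine le_trans (Finset.sum_le_sum fun j _ => ?_) hx1
        exact sq_le_sq.2 (abs_roundTowardsZero_le hn _)
      · rw [hy]
        exact le_trans (Finset.sum_le_sum fun j _ => abs_roundTowardsZero_le hn _) hl1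
    · rw [hy]
      have h1 : ∑ j, |x j - roundTowardsZero n (x j)|
          = ∑ j ∈ S, |x j - roundTowardsZero n (x j)| := by
        refine (Finset.sum_subset (Finset.subset_univ _) fun j _ hj => ?_).symm
        have hj0 : x j = 0 := by simpa [hS] using hj
        simp [hj0, roundTowardsZero_zero]
      calc ∑ j, |x j - roundTowardsZero n (x j)|
          = ∑ j ∈ S, |x j - roundTowardsZero n (x j)| := h1
        _ ≤ ∑ _j ∈ S, 1 / (n : ℝ) :=
            Finset.sum_le_sum fun j _ => abs_sub_roundTowardsZero_le hn _
        _ = S.card / n := by rw [Finset.sum_const, nsmul_eq_mul, mul_one_div]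
        _ ≤ s / n := by
            have : (S.card : ℝ) ≤ s := by exact_mod_cast hxs
            gcongr
  refine ⟨T, ?_, ?_, ?_, hnet⟩
  · obtain ⟨y, hy, -⟩ := hnet 0 (by simp [l0norm]) (by simp)
    exact ⟨y, hy⟩
  · refine (Finset.card_filter_le _ _).trans (Finset.card_image_le.trans (le_of_eq ?_))
    have : Fintype.card ℤˣ = 2 := rfl
    simp [this]
  · intro x hx
    exact (Finset.mem_filter.1 hx).2

section

variable {n : ℕ}

lemma ripConst_le {ι κ : Type*} [Fintype ι] [Fintype κ] {A : Matrix ι κ ℝ} {s : ℕ} {δ : ℝ}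
    (hδ : 0 ≤ δ) (h : ∀ x : κ → ℝ, l0norm x ≤ s → l2normSq x = 1 →
      |l2normSq (A *ᵥ x) - l2normSq x| ≤ δ) : ripConst A s ≤ δ := by
  refine csInf_le ⟨0, fun _ h => h.1⟩ ⟨hδ, fun x hx => ?_⟩
  have h0 : 0 ≤ l2normSq x := sq_nonneg _
  rcases h0.eq_or_lt with h0 | h0
  · have hx0 : x = 0 := by
      rw [l2normSq_eq_sum, eq_comm, Finset.sum_eq_zero_iff_of_nonneg fun _ _ => sq_nonneg _] at h0
      funext j
      simpa using h0 j (Finset.mem_univ j)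
    simp [hx0, l2normSq_eq_sum]
  · have hc : 0 < √(l2normSq x) := Real.sqrt_pos.2 h0
    have hc2 : √(l2normSq x) ^ 2 = l2normSq x := Real.sq_sqrt h0.le
    have h1 : l2normSq ((√(l2normSq x))⁻¹ • x) = 1 := by
      rw [l2normSq_smul, inv_pow, hc2, inv_mul_cancel₀ h0.ne']
    have h2 := h _ ((l0norm_smul (inv_ne_zero hc.ne') x).le.trans hx) h1
    rw [h1, Matrix.mulVec_smul, l2normSq_smul, inv_pow, hc2, abs_le, inv_mul_eq_div] at h2
    constructor
    · have := (le_div_iff₀ h0).1 (show 1 - δ ≤ l2normSq (A *ᵥ x) / l2normSq x by linarith [h2.1])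
      linarith
    · have := (div_le_iff₀ h0).1 (show l2normSq (A *ᵥ x) / l2normSq x ≤ 1 + δ by linarith [h2.2])
      linarith

lemma ripConst_min_card {ι κ : Type*} [Fintype ι] [Fintype κ] (A : Matrix ι κ ℝ) (s : ℕ) :
    ripConst A (min s (Fintype.card κ)) = ripConst A s := by
  have : ∀ x : κ → ℝ, l0norm x ≤ min s (Fintype.card κ) ↔ l0norm x ≤ s := fun x => by
    simp [l0norm_le_card]
  simp only [ripConst, ripBounds, this]

variable [NeZero n] {Ω : Finset (Fin n)}

lemma norm_partialConv_signVec_le (hΩ : Ω.Nonempty) (x : Fin n → ℝ) (ξ : Fin n → ℤˣ) :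
    ‖partialConv Ω x (signVec ξ)‖ ≤ ∑ j, |x j| := by
  have hm : (0 : ℝ) < Ω.card := by exact_mod_cast hΩ.card_pos
  have h0 : 0 ≤ ∑ j, |x j| := Finset.sum_nonneg fun _ _ => abs_nonneg _
  refine abs_le_of_sq_le_sq' ?_ h0 |>.2
  rw [EuclideanSpace.norm_sq_eq]
  calc _ ≤ ∑ _i : Ω, 1 / (Ω.card : ℝ) * (∑ j, |x j|) ^ 2 := by
        refine Finset.sum_le_sum fun i _ => ?_
        rw [Real.norm_eq_abs, sq_abs, partialConv_apply, mul_pow, div_pow, Real.sq_sqrt hm.le,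
          one_pow]
        refine mul_le_mul_of_nonneg_left ?_ (by positivity)
        rw [← sq_abs]
        refine pow_le_pow_left₀ (abs_nonneg _) ?_ 2
        refine (Finset.abs_sum_le_sum_abs _ _).trans (le_of_eq ?_)
        rw [← (Equiv.subLeft (i : Fin n)).sum_comp fun j => |x j|]
        refine Finset.sum_congr rfl fun k _ => ?_
        have : |((ξ k : ℤ) : ℝ)| = 1 := by
          rcases Int.units_eq_one_or (ξ k) with h | h <;> simp [h]
        rw [abs_mul, signVec_apply, this, mul_one, Equiv.subLeft_apply]
    _ = _ := by
        simp
        field_simp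

/-- It suffices to control the quadratic form on a net in `ℓ¹`-distance `s / n`. -/
lemma ripConst_partialCirculant_le (hΩ : Ω.Nonempty) {s : ℕ} {T : Finset (Fin n → ℝ)}
    (hT : ∀ x ∈ T, ∑ j, x j ^ 2 ≤ 1 ∧ ∑ j, |x j| ≤ √s)
    (hnet : ∀ x : Fin n → ℝ, l0norm x ≤ s → ∑ j, x j ^ 2 ≤ 1 →
        ∃ y ∈ T, ∑ j, |x j - y j| ≤ (s : ℝ) / n) (hs : 1 ≤ s) (ξ : Fin n → ℤˣ) {M : ℝ}
    (hM : 0 ≤ M) (hTM : ∀ y ∈ T,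
      |‖partialConv Ω y (signVec ξ)‖ ^ 2 - hsNormSq (partialConv Ω y)| ≤ M) :
    ripConst (partialCirculant Ω fun k => ((ξ k : ℤ) : ℝ)) s ≤ M + 4 * (s * √s) / n := by
  have hn : (0 : ℝ) < n := by exact_mod_cast Nat.pos_of_neZero n
  have hs1 : (1 : ℝ) ≤ √s := by rw [Real.one_le_sqrt]; exact_mod_cast hs
  refine ripConst_le (by positivity) fun x hx hx1 => ?_
  have e1 : l2normSq (partialCirculant Ω (fun k => ((ξ k : ℤ) : ℝ)) *ᵥ x)
      = ‖partialConv Ω x (signVec ξ)‖ ^ 2 := by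
    rw [l2normSq, toLp_partialCirculant_mulVec]
  rw [e1]
  rw [l2normSq_eq_sum] at hx1 ⊢
  obtain ⟨y, hyT, hxy⟩ := hnet x hx hx1.le
  obtain ⟨hy2, hy1⟩ := hT y hyT
  have hMy := hTM y hyT
  rw [hsNormSq_partialConv Ω hΩ] at hMy
  have hxl1 := sum_abs_le_sqrt_of_l0norm_le hx hx1.le
  set a := ‖partialConv Ω x (signVec ξ)‖ with ha
  set b := ‖partialConv Ω y (signVec ξ)‖ with hb
  have hab : |a - b| ≤ s / n := by
    refine (abs_norm_sub_norm_le _ _).trans ?_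
    rw [← sub_apply, partialConv_sub]
    exact (norm_partialConv_signVec_le hΩ _ _).trans hxy
  have ha1 : a ≤ √s := (norm_partialConv_signVec_le hΩ _ _).trans hxl1
  have hb1 : b ≤ √s := (norm_partialConv_signVec_le hΩ _ _).trans hy1
  have hab2 : |a ^ 2 - b ^ 2| ≤ s / n * (2 * √s) := by
    rw [sq_sub_sq, abs_mul, mul_comm]
    refine mul_le_mul hab ?_ (abs_nonneg _) (by positivity)
    rw [abs_of_nonneg (by positivity)]
    linarith
  have hxy2 : |∑ j, y j ^ 2 - ∑ j, x j ^ 2| ≤ s / n * 2 := by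
    rw [← Finset.sum_sub_distrib]
    calc |∑ j, (y j ^ 2 - x j ^ 2)| ≤ ∑ j, |y j ^ 2 - x j ^ 2| := Finset.abs_sum_le_sum_abs _ _
      _ ≤ ∑ j, |x j - y j| * 2 := by
          refine Finset.sum_le_sum fun j _ => ?_
          rw [sq_sub_sq, abs_mul, mul_comm, abs_sub_comm]
          refine mul_le_mul_of_nonneg_left ?_ (abs_nonneg _)
          have h1 := abs_add_le (y j) (x j)
          have h2 := abs_le_one_of_sum_sq_le hx1.le j
          have h3 := abs_le_one_of_sum_sq_le hy2 j
          linarith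
      _ ≤ _ := by
          rw [← Finset.sum_mul]
          exact mul_le_mul_of_nonneg_right hxy (by norm_num)
  have hdec : a ^ 2 - ∑ j, x j ^ 2
      = (b ^ 2 - ∑ j, y j ^ 2) + ((a ^ 2 - b ^ 2) + (∑ j, y j ^ 2 - ∑ j, x j ^ 2)) := by ring
  rw [hdec]
  have t1 := abs_add_le (b ^ 2 - ∑ j, y j ^ 2)
    ((a ^ 2 - b ^ 2) + (∑ j, y j ^ 2 - ∑ j, x j ^ 2))
  have t2 := abs_add_le (a ^ 2 - b ^ 2) (∑ j, y j ^ 2 - ∑ j, x j ^ 2)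
  have t3 : (s : ℝ) / n * 2 ≤ s / n * (2 * √s) := by gcongr; linarith
  have t4 : (s : ℝ) / n * (2 * √s) + s / n * (2 * √s) = 4 * (s * √s) / n := by ring
  linarith

/-- The columns of the partial circulant matrix of a sign vector are unit vectors. -/
lemma ripConst_one_partialCirculant_le (hΩ : Ω.Nonempty) (ξ : Fin n → ℤˣ) :
    ripConst (partialCirculant Ω fun k => ((ξ k : ℤ) : ℝ)) 1 ≤ 0 := by
  have hm : (0 : ℝ) < Ω.card := by exact_mod_cast hΩ.card_pos
  refine ripConst_le le_rfl fun x hx _ => ?_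
  rw [l0norm_eq_card, Finset.card_le_one_iff_subset_singleton] at hx
  obtain ⟨j, hj⟩ := hx
  have hxj : ∀ k, k ≠ j → x k = 0 := by
    intro k hk
    by_contra hne
    exact hk (Finset.mem_singleton.1 (hj (by simp [hne])))
  rw [l2normSq_eq_sum, l2normSq_eq_sum]
  simp only [partialCirculant_mulVec_apply]
  have h1 : ∀ i : Ω, ∑ k, ((ξ (i - k) : ℤ) : ℝ) * x k = ((ξ (i - j) : ℤ) : ℝ) * x j := fun i =>
    Finset.sum_eq_single j (fun k _ hk => by rw [hxj k hk, mul_zero]) (by simp)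
  have h2 : ∑ k, x k ^ 2 = x j ^ 2 :=
    Finset.sum_eq_single j (fun k _ hk => by rw [hxj k hk]; norm_num) (by simp)
  have h3 : ∀ i : Ω, (1 / √(Ω.card : ℝ) * (((ξ (i - j) : ℤ) : ℝ) * x j)) ^ 2
      = 1 / Ω.card * x j ^ 2 := by
    intro i
    have := intUnit_sq (ξ (i - j))
    rw [mul_pow, mul_pow, div_pow, Real.sq_sqrt hm.le, sq ((ξ (i - j) : ℤ) : ℝ), this]
    ring
  simp only [h1, h2, h3]
  simp
  field_simp
  simp

end

/-! ### Evaluation of the chaining bound -/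

lemma maxFactor_le {N : ℕ} {B : ℝ} (hB : 0 ≤ B) (h : 2 * Real.log (2 * N) ≤ B ^ 2) :
    maxFactor N ≤ B :=
  Real.sqrt_le_iff.2 ⟨hB, h⟩

lemma log_le_of_le_pow {n : ℕ} {a k : ℕ} (ha : 0 < a) (h : a ≤ n ^ k) :
    Real.log a ≤ k * Real.log n := by
  rw [← Real.log_pow]
  refine Real.log_le_log (by exact_mod_cast ha) (by exact_mod_cast h)

section

variable {n s : ℕ}

/-- Cardinality of the net of roundings of sparse vectors. -/
lemma maxFactor_sparse_net_le (hn : 2 ≤ n) (hs : 2 ≤ s) :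
    maxFactor ((n * (2 * (n + 1))) ^ s) ≤ 100 * √(s * Real.log n) := by
  have hlog : 0 < Real.log n := Real.log_pos (by exact_mod_cast hn)
  have hs' : (2 : ℝ) ≤ s := by exact_mod_cast hs
  refine maxFactor_le (by positivity) ?_
  have h1 : n * (2 * (n + 1)) ≤ n ^ 4 := by
    have : 2 * (n + 1) ≤ n * n * n := by nlinarith [Nat.mul_le_mul hn hn]
    calc n * (2 * (n + 1)) ≤ n * (n * n * n) := Nat.mul_le_mul_left _ this
      _ = n ^ 4 := by ring
  have h2 : 2 * (n * (2 * (n + 1))) ^ s ≤ n ^ (1 + 4 * s) := by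
    rw [pow_add, pow_one, pow_mul]
    exact Nat.mul_le_mul hn (Nat.pow_le_pow_left h1 s)
  have h3 := log_le_of_le_pow (by positivity) h2
  push_cast at h3 ⊢
  rw [mul_pow 100, Real.sq_sqrt (by positivity)]
  nlinarith

/-- Cardinality of the Fourier nets. The hypothesis `4 ^ j ≤ 2 s` lets the rounding up of the number
of atoms be absorbed in a constant. -/
lemma maxFactor_fourier_net_le (hn : 2 ≤ n) {j K : ℕ} (hj : (4 : ℝ) ^ j ≤ 2 * s)
    (hK : (K : ℝ) ≤ 384 * s / 4 ^ j + 1) (hK1 : 1 ≤ K) :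
    maxFactor ((2 * n) ^ K) ≤ 100 * √(s * Real.log n) / 2 ^ (j + 1) := by
  have hlog : 0 < Real.log n := Real.log_pos (by exact_mod_cast hn)
  refine maxFactor_le (by positivity) ?_
  have h2 : 2 * (2 * n) ^ K ≤ n ^ (1 + 2 * K) := by
    rw [pow_add, pow_one, pow_mul, sq]
    exact Nat.mul_le_mul hn (Nat.pow_le_pow_left (Nat.mul_le_mul_right n hn) K)
  have h3 := log_le_of_le_pow (by positivity) h2
  push_cast at h3 ⊢
  rw [div_pow, mul_pow 100, Real.sq_sqrt (by positivity), ← pow_mul, mul_comm (j + 1) 2, pow_mul]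
  have h4 : (K : ℝ) ≤ 386 * s / 4 ^ j := by
    have : 1 ≤ 2 * (s : ℝ) / 4 ^ j := by rw [le_div_iff₀ (by positivity)]; linarith
    calc (K : ℝ) ≤ 384 * s / 4 ^ j + 2 * s / 4 ^ j := by linarith
      _ = _ := by ring
  have hK1' : (1 : ℝ) ≤ K := by exact_mod_cast hK1
  calc 2 * Real.log (2 * (2 * n) ^ K) ≤ 2 * ((1 + 2 * K) * Real.log n) := by linarith
    _ ≤ 6 * K * Real.log n := by nlinarith
    _ ≤ 6 * (386 * s / 4 ^ j) * Real.log n := by gcongr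
    _ = 9264 * (s * Real.log n) / 4 ^ (j + 1) := by rw [pow_succ]; ring
    _ ≤ 100 ^ 2 * (s * Real.log n) / (2 ^ 2) ^ (j + 1) := by
        norm_num
        gcongr
        norm_num

/-- The scale reached by Maurey's method with at least `384 s / 4 ^ j` atoms. -/
lemma fourier_net_scale_le (hn : 2 ≤ n) (hs : 1 ≤ s) {j K : ℕ}
    (hK : 384 * (s : ℝ) / 4 ^ j ≤ K) :
    8 * √s * maxFactor (2 * n) / √K ≤ 2 ^ j * √(Real.log n) := by
  have hlog : 0 < Real.log n := Real.log_pos (by exact_mod_cast hn)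
  have hs0 : (0 : ℝ) < s := by exact_mod_cast hs
  have hK0 : (0 : ℝ) < K := lt_of_lt_of_le (by positivity) hK
  have h2 : 2 * (2 * n) ≤ n ^ 3 := by nlinarith [Nat.mul_le_mul hn hn]
  have h3 := log_le_of_le_pow (by positivity) h2
  have hM : maxFactor (2 * n) ≤ √(6 * Real.log n) := by
    refine Real.sqrt_le_sqrt ?_
    push_cast at h3 ⊢
    linarith
  rw [div_le_iff₀ (Real.sqrt_pos.2 hK0)]
  refine (mul_le_mul_of_nonneg_left hM (by positivity)).trans ?_
  refine abs_le_of_sq_le_sq' ?_ (by positivity) |>.2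
  simp only [mul_pow]
  rw [Real.sq_sqrt hs0.le, Real.sq_sqrt (by positivity), Real.sq_sqrt hlog.le,
    Real.sq_sqrt hK0.le, ← pow_mul, mul_comm j 2, pow_mul]
  rw [div_le_iff₀ (by positivity)] at hK
  norm_num
  nlinarith

/-- The number of scales in the chain is of order `log s`. -/
lemma clog_add_one_le (hs : 2 ≤ s) : (Nat.clog 4 (2 * s) + 1 : ℝ) ≤ 5 * Real.log s := by
  have h2s : 1 < 2 * s := by omega
  have h1 := Nat.pow_pred_clog_lt_self (b := 4) (by norm_num) h2s
  have hpos : 0 < Nat.clog 4 (2 * s) := Nat.clog_pos (by norm_num) (by omega)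
  have hs' : (2 : ℝ) ≤ s := by exact_mod_cast hs
  have h2 : ((4 : ℝ)) ^ (Nat.clog 4 (2 * s)).pred ≤ 2 * s := by exact_mod_cast h1.le
  have h3 := Real.log_le_log (by positivity) h2
  have hlog4 : Real.log 4 = 2 * Real.log 2 := by
    rw [show (4 : ℝ) = 2 ^ 2 by norm_num, Real.log_pow]; norm_num
  rw [Real.log_pow, Real.log_mul (by norm_num) (by positivity), hlog4] at h3
  have h4 : ((Nat.clog 4 (2 * s)).pred : ℝ) = Nat.clog 4 (2 * s) - 1 := by
    rw [Nat.pred_eq_sub_one, Nat.cast_sub hpos]; norm_num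
  rw [h4] at h3
  have h5 := Real.log_two_gt_d9
  have h6 : Real.log 2 ≤ Real.log s := Real.log_le_log (by norm_num) hs'
  nlinarith

/-- The chaining bound evaluated for partial circulant matrices. The scales of the chain, in the
supremum norm of the Fourier transform, are `√(log n) 2 ^ j` for `j = 0, …, J` with `4 ^ J ≥ 2 s`:
below `√(log n)` the whole net of sparse vectors is used, and the last scale exceeds `√s`, the
radius of the set. Each scale contributes equally to the first term, hence the factor `log s`,
while the contributions to the second term decay geometrically. -/
theorem expect_ripConst_le_of_two_le [NeZero n] (hn : 2 ≤ n) (hs : 2 ≤ s) {Ω : Finset (Fin n)}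
    (hΩ : Ω.Nonempty) :
    𝔼 ξ : Fin n → ℤˣ, ripConst (partialCirculant Ω fun k => ((ξ k : ℤ) : ℝ)) s ≤
      4000 * (√s / √(Ω.card : ℝ) * Real.log s * Real.log n) +
      640008 * (s * √s / Ω.card * (Real.log n * √(Real.log n))) := by
  classical
  set m : ℝ := ((Ω.card : ℕ) : ℝ) with hm
  have hm0 : 0 < m := by rw [hm]; exact_mod_cast hΩ.card_pos
  have hsm : 0 < √m := Real.sqrt_pos.2 hm0
  set ℓ : ℝ := Real.log n with hℓ
  have hn' : (2 : ℝ) ≤ n := by exact_mod_cast hn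
  have hs' : (2 : ℝ) ≤ s := by exact_mod_cast hs
  have hs0 : (0 : ℝ) < s := by linarith
  have hℓ2 : 0.69 ≤ ℓ := by
    have := Real.log_two_gt_d9
    have h6 : Real.log 2 ≤ Real.log n := Real.log_le_log (by norm_num) hn'
    linarith
  have hℓ0 : 0 < ℓ := by linarith
  obtain ⟨T, hTne, hTcard, hT, hTnet⟩ := exists_sparse_net (n := n) s
  -- With `K j` atoms, Maurey's method reaches the scale `8 √s √(2 log (4n)) / √(K j)`. Since
  -- `log (4n) ≤ 3 log n`, this is at most `2 ^ j √(log n)`.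
  set K : ℕ → ℕ := fun j => ⌈384 * (s : ℝ) / 4 ^ j⌉₊ with hK
  have hKpos : ∀ j, 0 < K j := fun j => Nat.ceil_pos.2 (by positivity)
  choose q hqT hqcard hqd using fun j =>
    exists_fourier_net T (Real.sqrt_pos.2 hs0) (fun x hx => (hT x hx).2) (hKpos j)
  simp only [Fintype.card_fin] at hqcard hqd
  set J := Nat.clog 4 (2 * s) with hJ
  set S : ℕ → Finset (Fin n → ℝ) := fun j => Nat.casesOn j T fun i => T.image (q i) with hS
  have hSne : ∀ j, (S j).Nonempty := by
    rintro (_ | j)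
    · exact hTne
    · exact hTne.image _
  have hST : ∀ j, ∀ x ∈ S j, x ∈ T := by
    rintro (_ | j) x hx
    · exact hx
    · obtain ⟨y, hy, rfl⟩ := Finset.mem_image.1 hx
      exact hqT j y hy
  set N : ℕ → ℕ := fun j => Nat.casesOn j ((n * (2 * (n + 1))) ^ s) fun i => (2 * n) ^ K i with hN
  have hNS : ∀ j ≤ J, (S j).card ≤ N j := by
    rintro (_ | j) -
    · exact hTcard
    · exact hqcard j
  have hNL : ∀ j ≤ J, maxFactor (N j) ≤ 100 * √(s * ℓ) / 2 ^ j := by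
    rintro (_ | j) hj
    · rw [pow_zero, div_one]
      exact maxFactor_sparse_net_le hn hs
    · refine maxFactor_fourier_net_le hn ?_ (Nat.ceil_lt_add_one (by positivity)).le (hKpos j)
      have h1 := Nat.pow_pred_clog_lt_self (b := 4) (by norm_num) (show 1 < 2 * s by omega)
      have h2 : 4 ^ j ≤ 2 * s :=
        (Nat.pow_le_pow_right (by norm_num) (Nat.le_pred_of_lt hj)).trans h1.le
      exact_mod_cast h2
  set D : ℕ → ℝ := fun j => 2 ^ j * √ℓ / √m with hD
  -- The last scale exceeds the radius of the set, so that zero approximates all points there.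
  have hJD : √s / √m ≤ D J := by
    simp only [hD]
    refine div_le_div_of_nonneg_right ?_ hsm.le
    refine Real.sqrt_le_iff.2 ⟨by positivity, ?_⟩
    rw [mul_pow, Real.sq_sqrt hℓ0.le, ← pow_mul, mul_comm J 2, pow_mul]
    have h1 : 2 * s ≤ 4 ^ J := Nat.le_pow_clog (by norm_num) _
    have h2 : (2 * s : ℝ) ≤ 4 ^ J := by exact_mod_cast h1
    norm_num
    nlinarith
  have hchain := expect_sup_chaos_le_sum S hSne N J hNS (partialConv Ω) q
    (fun j _ x hx => Finset.mem_image_of_mem _ (hST j x hx)) D (D' := √s / √m)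
    (fun j _ x hx => by
      rw [partialConv_sub]
      refine (norm_partialConv_le Ω _ (hqd j x (hST j x hx))).trans ?_
      exact div_le_div_of_nonneg_right
        (fourier_net_scale_le hn (by omega) (Nat.le_ceil _)) hsm.le)
    hJD
    (fun j _ x hx => norm_partialConv_le Ω x fun ψ =>
      (norm_fourierCoeffAt_le x ψ).trans (hT x (hST j x hx)).2)
    (fun j _ x hx => by
      rw [hsNormSq_partialConv Ω hΩ]
      exact (hT x (hST j x hx)).1)
  set Y : ℝ := √s / √m * ℓ with hY
  set Z : ℝ := s * √s / m * (ℓ * √ℓ) with hZ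
  have hY0 : 0 ≤ Y := by positivity
  have hZ0 : 0 ≤ Z := by positivity
  have hcost : ∀ j ∈ Finset.range (J + 1),
      8 * D j * maxFactor (N j) * (1 + 4 * (√s / √m) * maxFactor (N j)) ≤
        800 * Y + 320000 * Z * (1 / 2) ^ j := by
    intro j hj
    have hL := hNL j (by have := Finset.mem_range.1 hj; omega)
    have hL0 := maxFactor_nonneg (N j)
    calc _ ≤ 8 * D j * (100 * √(s * ℓ) / 2 ^ j) *
          (1 + 4 * (√s / √m) * (100 * √(s * ℓ) / 2 ^ j)) := by
          have : 0 ≤ D j := by simp only [hD]; positivity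
          gcongr
      _ = _ := by
          rw [Real.sqrt_mul hs0.le]
          have e1 : √(s : ℝ) * √s = s := Real.mul_self_sqrt hs0.le
          have e2 : √ℓ * √ℓ = ℓ := Real.mul_self_sqrt hℓ0.le
          have e3 : √m * √m = m := Real.mul_self_sqrt hm0.le
          have e4 : ((2 : ℝ) ^ j) ≠ 0 := by positivity
          have h1 : 8 * D j * (100 * (√s * √ℓ) / 2 ^ j) = 800 * Y := by
            calc _ = 800 * (√s / √m * (√ℓ * √ℓ)) := by
                  simp only [hD]
                  field_simp
                  ring
              _ = 800 * Y := by rw [e2]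
          rw [h1, mul_add, mul_one]
          congr 1
          rw [hY, hZ, one_div, inv_pow]
          calc _ = 320000 * ((√s * √s) * √s / (√m * √m) * (ℓ * √ℓ)) * (2 ^ j)⁻¹ := by
                field_simp
                norm_num
            _ = _ := by rw [e1, e3]
  have hgeom : ∑ j ∈ Finset.range (J + 1), ((1 : ℝ) / 2) ^ j ≤ 2 := by
    rw [geom_sum_eq (by norm_num)]
    have : (0 : ℝ) < (1 / 2) ^ (J + 1) := by positivity
    rw [div_le_iff_of_neg (by norm_num)]
    linarith
  have hsum : ∑ j ∈ Finset.range (J + 1),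
      8 * D j * maxFactor (N j) * (1 + 4 * (√s / √m) * maxFactor (N j)) ≤
        4000 * (√s / √m * Real.log s * ℓ) + 640000 * Z := by
    refine (Finset.sum_le_sum hcost).trans ?_
    rw [Finset.sum_add_distrib, ← Finset.mul_sum _ _ (320000 * Z), Finset.sum_const,
      Finset.card_range, nsmul_eq_mul]
    have h1 := clog_add_one_le hs
    push_cast
    have h2 : (J + 1 : ℝ) * (800 * Y) ≤ 5 * Real.log s * (800 * Y) := by gcongr
    have h3 : 320000 * Z * ∑ j ∈ Finset.range (J + 1), ((1 : ℝ) / 2) ^ j ≤ 320000 * Z * 2 := by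
      gcongr
    have h4 : 5 * Real.log s * (800 * Y) = 4000 * (√s / √m * Real.log s * ℓ) := by rw [hY]; ring
    linarith
  -- The rounding error is dominated by the second term because `m ≤ n`.
  have hround : 4 * (s * √s) / n ≤ 8 * Z := by
    have hmn : m ≤ n := by
      have := Finset.card_le_univ Ω
      rw [Fintype.card_fin] at this
      rw [hm]
      exact_mod_cast this
    have hsℓ : 0.8 ≤ √ℓ := Real.le_sqrt_of_sq_le (by norm_num at hℓ2 ⊢; linarith)
    have h1 : 1 / 2 ≤ ℓ * √ℓ := by nlinarith
    calc 4 * (s * √s) / n ≤ 4 * (s * √s) / m := by gcongr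
      _ = 8 * (s * √s / m) * (1 / 2) := by ring
      _ ≤ 8 * (s * √s / m) * (ℓ * √ℓ) := by gcongr
      _ = 8 * Z := by rw [hZ]; ring
  calc 𝔼 ξ : Fin n → ℤˣ, ripConst (partialCirculant Ω fun k => ((ξ k : ℤ) : ℝ)) s
      ≤ 𝔼 ξ : Fin n → ℤˣ, ((S 0).sup' (hSne 0) (fun x =>
          |‖partialConv Ω x (signVec ξ)‖ ^ 2 - hsNormSq (partialConv Ω x)|) +
          4 * (s * √s) / n) := by
        refine Finset.expect_le_expect fun ξ _ => ?_
        have hle := fun y (hy : y ∈ T) => Finset.le_sup' (s := S 0) (fun x =>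
          |‖partialConv Ω x (signVec ξ)‖ ^ 2 - hsNormSq (partialConv Ω x)|) hy
        refine ripConst_partialCirculant_le hΩ hT hTnet (by omega) ξ ?_ hle
        obtain ⟨y, hy⟩ := hTne
        exact (abs_nonneg _).trans (hle y hy)
    _ ≤ _ := by
        rw [Finset.expect_add_distrib, Fintype.expect_const]
        linarith

/-- The bound on the average over all sign vectors, without restrictions on `n` and `s`. -/
theorem expect_ripConst_le (hs : 1 ≤ s) {Ω : Finset (Fin n)} (hΩ : Ω.Nonempty) :
    𝔼 ξ : Fin n → ℤˣ, ripConst (partialCirculant Ω fun k => ((ξ k : ℤ) : ℝ)) s ≤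
      700000 * max ((s : ℝ) ^ (3 / 2 : ℝ) / Ω.card * Real.log n ^ (3 / 2 : ℝ))
        (√((s : ℝ) / Ω.card) * Real.log s * Real.log n) := by
  have hn : 1 ≤ n := by
    obtain ⟨i, -⟩ := hΩ
    have := i.2
    omega
  have : NeZero n := ⟨by omega⟩
  have hm : (0 : ℝ) < Ω.card := by exact_mod_cast hΩ.card_pos
  have hℓ0 : 0 ≤ Real.log n := Real.log_natCast_nonneg n
  have hls0 : 0 ≤ Real.log s := Real.log_natCast_nonneg s
  have h32 : ∀ t : ℝ, 0 ≤ t → t ^ (3 / 2 : ℝ) = t * √t := by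
    intro t ht
    rw [show (3 / 2 : ℝ) = 1 + 1 / 2 by norm_num, Real.rpow_add_of_nonneg ht (by norm_num)
      (by norm_num), Real.rpow_one, Real.sqrt_eq_rpow]
  rw [h32 _ (Nat.cast_nonneg s), h32 _ hℓ0, Real.sqrt_div (Nat.cast_nonneg s)]
  set A := (s : ℝ) * √s / Ω.card * (Real.log n * √(Real.log n)) with hA
  set B := √(s : ℝ) / √(Ω.card : ℝ) * Real.log s * Real.log n with hB
  have hA0 : 0 ≤ A := by positivity
  -- No vector has more than `n` nonzero entries.
  have hmin : ∀ ξ : Fin n → ℤˣ, ripConst (partialCirculant Ω fun k => ((ξ k : ℤ) : ℝ)) s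
      = ripConst (partialCirculant Ω fun k => ((ξ k : ℤ) : ℝ)) (min s n) := by
    intro ξ
    have := ripConst_min_card (partialCirculant Ω fun k => ((ξ k : ℤ) : ℝ)) s
    rw [Fintype.card_fin] at this
    exact this.symm
  simp only [hmin]
  rcases Nat.lt_or_ge (min s n) 2 with h | h
  · have h1 : min s n = 1 := by omega
    rw [h1]
    refine (Finset.expect_le Finset.univ_nonempty fun ξ _ =>
      ripConst_one_partialCirculant_le hΩ ξ).trans ?_
    exact mul_nonneg (by norm_num) (hA0.trans (le_max_left _ _))
  · have hss : ((min s n : ℕ) : ℝ) ≤ s := by exact_mod_cast min_le_left s n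
    have hs2 : (2 : ℝ) ≤ (min s n : ℕ) := by exact_mod_cast h
    refine (expect_ripConst_le_of_two_le (by omega) h hΩ).trans ?_
    have hlog : Real.log (min s n : ℕ) ≤ Real.log s := Real.log_le_log (by linarith) hss
    have h1 : √((min s n : ℕ) : ℝ) / √(Ω.card : ℝ) * Real.log (min s n : ℕ) * Real.log n ≤ B := by
      rw [hB]
      gcongr
    have h2 : ((min s n : ℕ) : ℝ) * √((min s n : ℕ) : ℝ) / Ω.card *
        (Real.log n * √(Real.log n)) ≤ A := by
      rw [hA]
      gcongr
    have h3 := le_max_left A B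
    have h4 := le_max_right A B
    linarith

end

/-! ### Rademacher sequences -/

section

variable {S : Type*} [MeasurableSpace S] {P : Measure S} {n : ℕ}
  {ε : Fin n → S → ℝ}

lemma IsRademacher.measurableSet_signs (hε : IsRademacher P ε) (ξ : Fin n → ℤˣ) :
    MeasurableSet (⋂ k, ε k ⁻¹' {((ξ k : ℤ) : ℝ)}) :=
  MeasurableSet.iInter fun k => hε.measurable k (measurableSet_singleton _)

lemma IsRademacher.measureReal_signs (hε : IsRademacher P ε) (ξ : Fin n → ℤˣ) :
    P.real (⋂ k, ε k ⁻¹' {((ξ k : ℤ) : ℝ)}) = (1 / 2) ^ n := by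
  have h := hε.indep.meas_iInter (s := fun k => ε k ⁻¹' {((ξ k : ℤ) : ℝ)})
    fun k => ⟨_, measurableSet_singleton _, rfl⟩
  have hk : ∀ k, P (ε k ⁻¹' {((ξ k : ℤ) : ℝ)}) = 1 / 2 := by
    intro k
    rcases Int.units_eq_one_or (ξ k) with h | h
    · rw [h, Units.val_one, Int.cast_one]
      exact hε.prob_one k
    · rw [h, Units.val_neg, Units.val_one, Int.cast_neg, Int.cast_one]
      exact hε.prob_neg_one k
  rw [Measure.real, h]
  simp [hk]

variable [IsProbabilityMeasure P]

lemma IsRademacher.ae_eq_signs (hε : IsRademacher P ε) :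
    ∀ᵐ ω ∂P, ∃ ξ : Fin n → ℤˣ, ∀ k, ε k ω = ((ξ k : ℤ) : ℝ) := by
  have h : ∀ k, ∀ᵐ ω ∂P, ε k ω = 1 ∨ ε k ω = -1 := by
    intro k
    have h1 : MeasurableSet {ω | ε k ω = 1} := hε.measurable k (measurableSet_singleton 1)
    have h2 : MeasurableSet {ω | ε k ω = -1} := hε.measurable k (measurableSet_singleton (-1))
    have hd : Disjoint {ω | ε k ω = 1} {ω | ε k ω = -1} := by
      rw [Set.disjoint_left]
      intro ω hω hω'
      have h1 : ε k ω = 1 := hω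
      have h2 : ε k ω = -1 := hω'
      linarith
    have hu : P ({ω | ε k ω = 1} ∪ {ω | ε k ω = -1}) = 1 := by
      rw [measure_union hd h2, hε.prob_one, hε.prob_neg_one, ENNReal.add_halves]
    exact (prob_compl_eq_zero_iff (h1.union h2)).2 hu
  filter_upwards [ae_all_iff.2 h] with ω hω
  refine ⟨fun k => if ε k ω = 1 then 1 else -1, fun k => ?_⟩
  rcases hω k with h | h
  · simp [h]
  · simp only [h]
    norm_num

/-- Every function of a Rademacher sequence is integrable (it takes almost surely finitely many
values), and its expectation is the average over all sign vectors. -/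
lemma IsRademacher.integrable_and_integral_eq (hε : IsRademacher P ε) (f : (Fin n → ℝ) → ℝ) :
    Integrable (fun ω => f fun k => ε k ω) P ∧
      ∫ ω, f (fun k => ε k ω) ∂P = 𝔼 ξ : Fin n → ℤˣ, f fun k => ((ξ k : ℤ) : ℝ) := by
  classical
  set A : (Fin n → ℤˣ) → Set S := fun ξ => ⋂ k, ε k ⁻¹' {((ξ k : ℤ) : ℝ)} with hA
  set c : (Fin n → ℤˣ) → ℝ := fun ξ => f fun k => ((ξ k : ℤ) : ℝ) with hc
  have hae : (fun ω => f fun k => ε k ω) =ᵐ[P] fun ω => ∑ ξ, (A ξ).indicator (fun _ => c ξ) ω := by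
    filter_upwards [hε.ae_eq_signs] with ω ⟨ξ, hξ⟩
    rw [Finset.sum_eq_single ξ]
    · rw [Set.indicator_of_mem (by simpa [hA] using hξ)]
      simp only [hc, hξ]
    · intro ζ _ hne
      refine Set.indicator_of_notMem (fun hmem => hne ?_) _
      funext k
      have h1 : ε k ω = ((ζ k : ℤ) : ℝ) := by simpa using Set.mem_iInter.1 hmem k
      rw [hξ k] at h1
      exact (Units.ext (by exact_mod_cast h1)).symm
    · simp
  have hint : ∀ ξ, Integrable ((A ξ).indicator fun _ => c ξ) P := fun ξ =>
    (integrable_const (c ξ)).indicator (hε.measurableSet_signs ξ)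
  refine ⟨(integrable_finsetSum _ fun ξ _ => hint ξ).congr hae.symm, ?_⟩
  rw [integral_congr_ae hae, integral_finsetSum _ fun ξ _ => hint ξ,
    Fintype.expect_eq_sum_div_card, Finset.sum_div]
  refine Finset.sum_congr rfl fun ξ _ => ?_
  rw [integral_indicator_const _ (hε.measurableSet_signs ξ), hε.measureReal_signs]
  have : Fintype.card ℤˣ = 2 := rfl
  simp [hc, this]
  ring

/-- The expectation bound with an explicit constant, so that the same constant serves for
probability spaces in every universe. -/
lemma IsRademacher.integrable_and_integral_ripConst_le (hε : IsRademacher P ε) {s : ℕ}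
    (hs : 1 ≤ s) {Ω : Finset (Fin n)} (hΩ : Ω.Nonempty) :
    Integrable (fun ω => ripConst (partialCirculant Ω (fun k => ε k ω)) s) P ∧
      ∫ ω, ripConst (partialCirculant Ω (fun k => ε k ω)) s ∂P ≤
        700000 * max ((s : ℝ) ^ (3 / 2 : ℝ) / Ω.card * Real.log n ^ (3 / 2 : ℝ))
          (√((s : ℝ) / Ω.card) * Real.log s * Real.log n) := by
  obtain ⟨h1, h2⟩ := hε.integrable_and_integral_eq fun φ => ripConst (partialCirculant Ω φ) s
  exact ⟨h1, h2.le.trans (expect_ripConst_le hs hΩ)⟩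

end

theorem theorem1 :
    (∃ C₁ : ℝ, 0 < C₁ ∧
      ∀ (n m s : ℕ), 1 ≤ m → 1 ≤ s →
      ∀ Ω : Finset (Fin n), Ω.card = m →
      ∀ (S : Type*) [MeasurableSpace S] (P : Measure S) [IsProbabilityMeasure P]
        (ε : Fin n → S → ℝ), IsRademacher P ε →
        Integrable (fun ω => ripConst (partialCirculant Ω (fun k => ε k ω)) s) P ∧
        ∫ ω, ripConst (partialCirculant Ω (fun k => ε k ω)) s ∂P ≤
          C₁ * max ((s : ℝ) ^ (3 / 2 : ℝ) / (m : ℝ) * Real.log n ^ (3 / 2 : ℝ))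
            (Real.sqrt ((s : ℝ) / (m : ℝ)) * Real.log s * Real.log n)) ∧
    (∃ C₂ : ℝ, 0 < C₂ ∧
      ∀ (n m s : ℕ), 1 ≤ m → 1 ≤ s →
      ∀ δ : ℝ, 0 < δ → δ < 1 →
        (m : ℝ) ≥ C₂ * max (δ⁻¹ * (s : ℝ) ^ (3 / 2 : ℝ) * Real.log n ^ (3 / 2 : ℝ))
          ((δ ^ 2)⁻¹ * (s : ℝ) * Real.log n ^ 2 * Real.log s ^ 2) →
      ∀ Ω : Finset (Fin n), Ω.card = m →
      ∀ (S : Type*) [MeasurableSpace S] (P : Measure S) [IsProbabilityMeasure P]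
        (ε : Fin n → S → ℝ), IsRademacher P ε →
        ∫ ω, ripConst (partialCirculant Ω (fun k => ε k ω)) s ∂P ≤ δ) := by
  refine ⟨⟨700000, by norm_num, ?_⟩, ⟨700000 ^ 2, by norm_num, ?_⟩⟩
  · intro n m s hm hs Ω hΩ S _ P _ ε hε
    subst hΩ
    exact hε.integrable_and_integral_ripConst_le hs (Finset.card_pos.1 hm)
  · intro n m s hm hs δ hδ _ hmδ Ω hΩ S _ P _ ε hε
    subst hΩ
    refine (hε.integrable_and_integral_ripConst_le hs (Finset.card_pos.1 hm)).2.trans ?_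
    have hm0 : (0 : ℝ) < Ω.card := by exact_mod_cast hm
    have hℓ0 : 0 ≤ Real.log n := Real.log_natCast_nonneg n
    have hls0 : 0 ≤ Real.log s := Real.log_natCast_nonneg s
    rw [ge_iff_le, mul_max_of_nonneg _ _ (by norm_num), max_le_iff] at hmδ
    obtain ⟨h1, h2⟩ := hmδ
    rw [mul_max_of_nonneg _ _ (by norm_num), max_le_iff]
    constructor
    · set X := (s : ℝ) ^ (3 / 2 : ℝ) * Real.log n ^ (3 / 2 : ℝ) with hX
      have hX0 : 0 ≤ X := by positivity
      have h3 : 700000 ^ 2 * X ≤ Ω.card * δ := by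
        have h4 : 700000 ^ 2 * (δ⁻¹ * (s : ℝ) ^ (3 / 2 : ℝ) * Real.log n ^ (3 / 2 : ℝ))
            = 700000 ^ 2 * X / δ := by rw [hX]; ring
        rwa [h4, div_le_iff₀ hδ] at h1
      have h5 : 700000 * ((s : ℝ) ^ (3 / 2 : ℝ) / Ω.card * Real.log n ^ (3 / 2 : ℝ))
          = 700000 * X / Ω.card := by rw [hX]; ring
      rw [h5, div_le_iff₀ hm0]
      linarith
    · refine abs_le_of_sq_le_sq' ?_ hδ.le |>.2
      simp only [mul_pow]
      rw [Real.sq_sqrt (by positivity)]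
      have h4 : 700000 ^ 2 * ((δ ^ 2)⁻¹ * (s : ℝ) * Real.log n ^ 2 * Real.log s ^ 2)
          = 700000 ^ 2 * (s * Real.log s ^ 2 * Real.log n ^ 2) / δ ^ 2 := by ring
      rw [h4, div_le_iff₀ (by positivity)] at h2
      have h5 : 700000 ^ 2 * ((s : ℝ) / Ω.card * Real.log s ^ 2 * Real.log n ^ 2)
          = 700000 ^ 2 * (s * Real.log s ^ 2 * Real.log n ^ 2) / Ω.card := by ring
      rw [h5, div_le_iff₀ hm0]
      linarith
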